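/- Let $f,g\in\mathbb{Q}[x]$ with $g\neq 0$, where $f$ has no positive integer zeros, and let $u_0\in\mathbb{Q}$. The associated hypergeometric sequence $(u_n)_{n\ge 0}$ of rational numbers is defined by $f(n)u_n=g(n)u_{n-1}$ for $n\ge 1$. It belongs to class $\mathscr{D}$ if it is not rational (there is no rational function $q\in\mathbb{Q}(x)$, without poles at the integers $n\ge 0$, such that $u_n=q(n)$ for all $n\ge 0$) and the complex roots of $f$ and of $g$, listed with multiplicity, cannot be put into a one-to-one correspondence such that corresponding roots $\alpha,\beta$ satisfy $\mathbb{Q}(\alpha)=\mathbb{Q}(\beta)$. (In particular no such correspondence exists if $\deg f\ne\deg g$.) The Membership Problem is decidable for the hypergeometric sequences in class $\mathscr{D}$ that satisfy at least one of the following conditions: 1. each irreducible factor of $fg$ over $\mathbb{Q}$ has degree at most two; 2. the splitting field of $fg$ is a cyclic extension of $\mathbb{Q}$ (for instance $\mathbb{Q}(\zeta_p)$ with $p$ prime, or any other cyclotomic field with cyclic Galois group). That is, there is one algorithm which, given $f$, $g$, $u_0$ as above, such that the sequence is in class $\mathscr{D}$ and satisfies (1) or (2), and a target $t\in\mathbb{Q}$,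 halts and correctly answers whether $u_n=t$ for some $n\ge 0$. -/

import Mathlib

open Polynomial IntermediateField

namespace HypergeometricMembership

/-- The rational-valued sequence `u` is hypergeometric with coefficients `f` and `g`:
`f` has no positive integer zero, `g` is not the zero polynomial, and
`f(n) u_n = g(n) u_{n-1}` for all `n ≥ 1` (written with `n + 1` in place of `n`). -/
structure IsHypergeometric (f g : ℚ[X]) (u : ℕ → ℚ) : Prop where
  den_ne_zero : ∀ n : ℕ, 1 ≤ n → f.eval (n : ℚ) ≠ 0
  num_ne_zero : g ≠ 0
  recurrence : ∀ n : ℕ, f.eval ((n + 1 : ℕ) : ℚ) * u (n + 1) = g.eval ((n + 1 : ℕ) : ℚ) * u n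

/-- The sequence `u` is given by a rational function without poles at the natural numbers. -/
def IsRationalSeq (u : ℕ → ℚ) : Prop :=
  ∃ p q : ℚ[X], ∀ n : ℕ, q.eval (n : ℚ) ≠ 0 ∧ u n = p.eval (n : ℚ) / q.eval (n : ℚ)

/-- The complex roots of `f` and of `g`, listed with multiplicity, can be matched one to one
(so that there are equally many of them) in such a way that matched roots `α`, `β` generate
the same subfield `ℚ(α) = ℚ(β)` of `ℂ`. -/
def SameRootFields (f g : ℚ[X]) : Prop :=
  Multiset.Rel (fun α β : ℂ => ℚ⟮α⟯ = ℚ⟮β⟯) (f.aroots ℂ) (g.aroots ℂ)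

/-- Class `𝒟`: the non-rational hypergeometric sequences whose parameters cannot be
rearranged so that corresponding parameters generate the same field. -/
structure ClassD (f g : ℚ[X]) (u : ℕ → ℚ) : Prop where
  hypergeometric : IsHypergeometric f g u
  not_rational : ¬ IsRationalSeq u
  not_same : ¬ SameRootFields f g

/-- Every irreducible factor over `ℚ` of `P` has degree at most two. -/
def FactorsDegreeLeTwo (P : ℚ[X]) : Prop :=
  ∀ h : ℚ[X], Irreducible h → h ∣ P → h.natDegree ≤ 2

/-- The splitting field of `P` is a cyclic extension of `ℚ`. -/
def CyclicSplittingField (P : ℚ[X]) : Prop :=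
  IsGalois ℚ P.SplittingField ∧ IsCyclic (P.SplittingField ≃ₐ[ℚ] P.SplittingField)

/-- Finite codes of rational numbers: the pair `(a, b)` stands for `a / (b + 1)`. -/
abbrev RatCode := ℤ × ℕ

/-- The rational number with a given code. -/
def RatCode.value (c : RatCode) : ℚ := (c.1 : ℚ) / ((c.2 : ℚ) + 1)

/-- The polynomial with a given list of codes of coefficients, constant coefficient first. -/
noncomputable def polyOfCodes : List RatCode → ℚ[X]
  | [] => 0
  | c :: l => C (RatCode.value c) + X * polyOfCodes l

/-- An instance of the Membership Problem: codes for `f`, `g`, `u_0` and the target `t`. -/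
abbrev MembershipInput := List RatCode × List RatCode × RatCode × RatCode

/-- The Membership Problem is decidable for the hypergeometric sequences satisfying `P`: there
is one algorithm (a partial recursive function) that, given codes for `f`, `g`, `u_0` and `t`,
where `u` is the sequence with these coefficients and this initial value and satisfies `P`,
halts and correctly answers whether `u_n = t` for some `n`. -/
def MembershipDecidable (P : ℚ[X] → ℚ[X] → (ℕ → ℚ) → Prop) : Prop :=
  ∃ A : MembershipInput →. Bool, Partrec A ∧
    ∀ (cf cg : List RatCode) (c₀ ct : RatCode) (u : ℕ → ℚ),
      IsHypergeometric (polyOfCodes cf) (polyOfCodes cg) u →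
      u 0 = RatCode.value c₀ →
      P (polyOfCodes cf) (polyOfCodes cg) u →
      ∃ b : Bool, b ∈ A (cf, cg, c₀, ct) ∧ (b = true ↔ ∃ n : ℕ, u n = RatCode.value ct)

end HypergeometricMembership

/-!
The algorithm searches for an index `n` with `u n = t` and, at the same time, for a certificate that
there is none. For `t = 0` a certificate is a nonzero term beyond the last zero of `g`.

For `t ≠ 0` the certificate rests on a prime `p`. Write an integer multiple of `f` and of `g` as
products of integer polynomials, irreducible up to constants, and let `R_f(p)` and `R_g(p)` be the
total numbers of roots modulo `p` of these factors. When the roots are simple, Hensel's lemma gives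
the exponent of `p` in `∏ f(k)` and in `∏ g(k)`, over `1 ≤ k ≤ n`, up to an error `O(log n)`: it is
the number of roots times `∑_j ⌊n / p ^ j⌋`. If `R_f(p) ≠ R_g(p)`, the exponents are so far apart
for large `n` that `u n = u 0 * ∏ g(k) / ∏ f(k)` cannot be `t`, and the bound for `n` is explicit
(`lt_of_mul_prod_prodEval_eq`). The certificate consists of the factors, of `p`, and of the finitely
many terms below the bound. Everything in it can be tested by a primitive recursive function.

It remains to find `p`. Under either hypothesis on `f * g`, every root `α` generates a Galois
extension `ℚ(α)` of `ℚ`. For large `p` the polynomial factor with root `α` splits modulo `p` if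
`ℚ(α)` embeds into `ℚ_p`, and has no root otherwise (`eventually_ncard_modRoots`). Hence `R_f(p)` is
the sum over the roots `α` of `f` of the indicators `s_p(ℚ(α))` of such an embedding. If `R_f(p)`
and `R_g(p)` agreed for all large `p`, then `∑ c_K s_p(K) = 0` for these `p`, where `c_K` is the
difference of the multiplicities of `K` among the fields `ℚ(α)` for `f` and for `g`. Two facts about
the indicators show that all `c_K` vanish, against the assumption that the roots cannot be matched:

* `s_p` has Dirichlet mean `1 / [K : ℚ]` over the primes (`hasPrimeMean_padicIndicator`), by the
  simple pole at `1` and the Euler product of the Dedekind zeta function of `K`;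
* `s_p(K K') = s_p(K) s_p(K')` (`padicIndicator_sup`), so that the inner product of the indicators
  of `K` and `K'` is `1 / [K K' : ℚ]`.

For fields of degree at most two these inner products are inverted directly
(`eq_zero_of_finrank_le_two`). In a cyclic extension with group `G`, they show that the function
`σ ↦ ∑ c_K`, the sum over the fields `K` fixed by `σ`, has square sum zero on `G`. A generator of
`Gal(L/K)` fixes exactly the subfields of `K`, and induction on `K` yields `c_K = 0`
(`eq_zero_of_isCyclic`).
-/

namespace HypergeometricMembership

/-! ### Ideal counts and the Dedekind zeta function near `1` -/

section Zeta
open NumberField Ideal UniqueFactorizationMonoid Filter Topology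

variable (K : Type*) [Field K] [NumberField K]

/-- The number of ideals of norm `n` in the ring of integers of `K`. -/
noncomputable def idealCount (n : ℕ) : ℕ := Nat.card {I : Ideal (𝓞 K) // absNorm I = n}

lemma idealCount_one : idealCount K 1 = 1 := by
  unfold idealCount
  rw [Nat.card_eq_one_iff_unique]
  refine ⟨⟨fun a b => Subtype.ext ?_⟩, ⟨⟨⊤, by simp⟩⟩⟩
  rw [absNorm_eq_one_iff.mp a.2, absNorm_eq_one_iff.mp b.2]

omit [NumberField K] in
lemma sup_span_natCast_eq_top {m n : ℕ} (hmn : m.Coprime n) {J : Ideal (𝓞 K)} (hJ : (n : 𝓞 K) ∈ J) :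
    J ⊔ span {(m : 𝓞 K)} = ⊤ := by
  rw [eq_top_iff_one]
  have h := Nat.isCoprime_iff_coprime.mpr hmn
  obtain ⟨a, b, hab⟩ := h
  have : (1 : 𝓞 K) = (b : 𝓞 K) * n + (a : 𝓞 K) * m := by
    have := congrArg (Int.cast : ℤ → 𝓞 K) hab
    push_cast at this
    rw [← this]; ring
  rw [this]
  exact Submodule.add_mem_sup (J.mul_mem_left _ hJ)
    (Ideal.mul_mem_left _ _ (mem_span_singleton_self _))

lemma mul_sup_span_natCast {m n : ℕ} (hmn : m.Coprime n) {I J : Ideal (𝓞 K)}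
    (hI : absNorm I = m) (hJ : absNorm J = n) : I * J ⊔ span {(m : 𝓞 K)} = I := by
  have hm : (m : 𝓞 K) ∈ I := hI ▸ absNorm_mem I
  have hn : (n : 𝓞 K) ∈ J := hJ ▸ absNorm_mem J
  apply le_antisymm
  · exact sup_le Ideal.mul_le_left ((span_singleton_le_iff_mem _).mpr hm)
  · calc I = I * (J ⊔ span {(m : 𝓞 K)}) := by rw [sup_span_natCast_eq_top K hmn hn, Ideal.mul_top]
      _ = I * J ⊔ I * span {(m : 𝓞 K)} := Ideal.mul_sup _ _ _
      _ ≤ _ := sup_le_sup le_rfl Ideal.mul_le_right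

lemma sup_span_mul_sup_span {m n : ℕ} (hmn : m.Coprime n) {I : Ideal (𝓞 K)}
    (hI : absNorm I = m * n) : (I ⊔ span {(m : 𝓞 K)}) * (I ⊔ span {(n : 𝓞 K)}) = I := by
  have hI' : ((m * n : ℕ) : 𝓞 K) ∈ I := hI ▸ absNorm_mem I
  apply le_antisymm
  · rw [Ideal.sup_mul, Ideal.mul_sup, Ideal.mul_sup]
    refine sup_le (sup_le Ideal.mul_le_left Ideal.mul_le_left) (sup_le Ideal.mul_le_right ?_)
    rw [span_singleton_mul_span_singleton, span_singleton_le_iff_mem]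
    exact_mod_cast hI'
  · have h1 : span {(m : 𝓞 K)} ⊔ span {(n : 𝓞 K)} = ⊤ := by
      rw [sup_comm]
      exact sup_span_natCast_eq_top K hmn (mem_span_singleton_self _)
    calc I = I * (span {(m : 𝓞 K)} ⊔ span {(n : 𝓞 K)}) := by rw [h1, Ideal.mul_top]
      _ = span {(m : 𝓞 K)} * I ⊔ I * span {(n : 𝓞 K)} := by rw [Ideal.mul_sup, Ideal.mul_comm]
      _ ≤ _ := sup_le (Ideal.mul_mono le_sup_right le_sup_left)
          (Ideal.mul_mono le_sup_left le_sup_right)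

lemma absNorm_span_natCast (m : ℕ) :
    absNorm (span {(m : 𝓞 K)}) = m ^ Module.finrank ℤ (𝓞 K) := by
  rw [absNorm_span_singleton]
  have := Algebra.norm_algebraMap (S := 𝓞 K) (m : ℤ)
  simp only [algebraMap_int_eq, eq_intCast, Int.cast_natCast] at this
  rw [this, Int.natAbs_pow, Int.natAbs_natCast]

lemma absNorm_sup_span_dvd {m n : ℕ} (hmn : m.Coprime n) {I : Ideal (𝓞 K)}
    (hI : absNorm I = m * n) : absNorm (I ⊔ span {(m : 𝓞 K)}) ∣ m := by
  have h1 : absNorm (I ⊔ span {(m : 𝓞 K)}) ∣ m ^ Module.finrank ℤ (𝓞 K) := by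
    rw [← absNorm_span_natCast]; exact absNorm_dvd_absNorm_of_le le_sup_right
  have h2 : absNorm (I ⊔ span {(m : 𝓞 K)}) ∣ m * n := by
    rw [← hI]; exact absNorm_dvd_absNorm_of_le le_sup_left
  exact (Nat.Coprime.coprime_dvd_left h1 (hmn.pow_left _)).dvd_of_dvd_mul_right h2

/-- The number of ideals of given norm is a multiplicative function: an ideal `I` of norm `mn`
with `m`, `n` coprime is the product of `I + (m)` and `I + (n)`. -/
lemma idealCount_mul {m n : ℕ} (hmn : m.Coprime n) (hm : m ≠ 0) (hn : n ≠ 0) :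
    idealCount K (m * n) = idealCount K m * idealCount K n := by
  unfold idealCount
  rw [← Nat.card_prod]
  symm
  refine Nat.card_congr
    { toFun := fun x => ⟨x.1.1 * x.2.1, by rw [map_mul, x.1.2, x.2.2]⟩
      invFun := fun I => ⟨⟨I.1 ⊔ span {(m : 𝓞 K)}, ?_⟩, ⟨I.1 ⊔ span {(n : 𝓞 K)}, ?_⟩⟩
      left_inv := ?_
      right_inv := ?_ }
  · have h1 := absNorm_sup_span_dvd K hmn I.2
    have h2 := absNorm_sup_span_dvd K hmn.symm (I.2.trans (mul_comm _ _))
    have h3 := congrArg absNorm (sup_span_mul_sup_span K hmn I.2)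
    rw [map_mul, I.2] at h3
    refine le_antisymm (Nat.le_of_dvd (Nat.pos_of_ne_zero hm) h1) ?_
    by_contra hlt
    rw [not_le] at hlt
    exact absurd h3 (ne_of_lt (Nat.mul_lt_mul_of_lt_of_le hlt
      (Nat.le_of_dvd (Nat.pos_of_ne_zero hn) h2) (Nat.pos_of_ne_zero hn)))
  · have h1 := absNorm_sup_span_dvd K hmn I.2
    have h2 := absNorm_sup_span_dvd K hmn.symm (I.2.trans (mul_comm _ _))
    have h3 := congrArg absNorm (sup_span_mul_sup_span K hmn I.2)
    rw [map_mul, I.2] at h3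
    refine le_antisymm (Nat.le_of_dvd (Nat.pos_of_ne_zero hn) h2) ?_
    by_contra hlt
    rw [not_le] at hlt
    exact absurd h3 (ne_of_lt (Nat.mul_lt_mul_of_le_of_lt
      (Nat.le_of_dvd (Nat.pos_of_ne_zero hm) h1) hlt (Nat.pos_of_ne_zero hm)))
  · rintro ⟨⟨I, hI⟩, ⟨J, hJ⟩⟩
    simp only [Prod.mk.injEq, Subtype.mk.injEq]
    refine ⟨mul_sup_span_natCast K hmn hI hJ, ?_⟩
    rw [Ideal.mul_comm]
    exact mul_sup_span_natCast K hmn.symm hJ hI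
  · rintro ⟨I, hI⟩
    simp only [Subtype.mk.injEq]
    exact sup_span_mul_sup_span K hmn hI

lemma card_normalizedFactors_le {p : ℕ} (hp : p.Prime) {e : ℕ} {I : Ideal (𝓞 K)}
    (hI : absNorm I = p ^ e) : (normalizedFactors I).card ≤ e := by
  have hI0 : I ≠ 0 := by
    rintro rfl
    exact pow_ne_zero e hp.ne_zero (by simpa using hI.symm)
  have h1 : ((normalizedFactors I).map absNorm).prod = p ^ e := by
    rw [← map_multiset_prod, associated_iff_eq.mp (prod_normalizedFactors hI0), hI]
  have h2 : p ^ ((normalizedFactors I).map absNorm).card ≤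
      ((normalizedFactors I).map absNorm).prod := by
    refine Multiset.pow_card_le_prod ?_
    intro x hx
    obtain ⟨P, hP, rfl⟩ := Multiset.mem_map.mp hx
    have hd : absNorm P ∣ p ^ e := hI ▸ map_dvd absNorm (dvd_of_mem_normalizedFactors hP)
    obtain ⟨k, hk, hk'⟩ := (Nat.dvd_prime_pow hp).mp hd
    rw [hk']
    refine Nat.le_self_pow ?_ p
    rintro rfl
    rw [pow_zero, absNorm_eq_one_iff] at hk'
    exact (prime_of_normalized_factor P hP).not_isUnit (Ideal.isUnit_iff.mpr hk')
  rw [h1, Multiset.card_map] at h2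
  exact (Nat.pow_le_pow_iff_right hp.one_lt).mp h2

/-- An ideal of norm `p ^ e` is determined by the exponents, at most `e`, of the at most
`[K : ℚ]` primes above `p`. -/
lemma idealCount_prime_pow_le {p : ℕ} (hp : p.Prime) (e : ℕ) :
    idealCount K (p ^ e) ≤ (e + 1) ^ Module.finrank ℤ (𝓞 K) := by
  classical
  set S := (normalizedFactors (span {(p : 𝓞 K)})).toFinset with hS
  have hcard : S.card ≤ Module.finrank ℤ (𝓞 K) :=
    (Multiset.toFinset_card_le _).trans
      (card_normalizedFactors_le K hp (absNorm_span_natCast K p))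
  have hmem : ∀ I : Ideal (𝓞 K), absNorm I = p ^ e → ∀ P ∈ normalizedFactors I, P ∈ S := by
    intro I hI P hP
    have hPp := prime_of_normalized_factor P hP
    rw [hS, Multiset.mem_toFinset, UniqueFactorizationMonoid.mem_normalizedFactors_iff
      (by simpa using hp.ne_zero)]
    refine ⟨hPp, Ideal.dvd_iff_le.mpr ((span_singleton_le_iff_mem _).mpr ?_)⟩
    have h1 : ((p ^ e : ℕ) : 𝓞 K) ∈ P :=
      Ideal.le_of_dvd (dvd_of_mem_normalizedFactors hP) (hI ▸ absNorm_mem I)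
    rw [Nat.cast_pow] at h1
    exact (Ideal.isPrime_of_prime hPp).mem_of_pow_mem _ h1
  have hcount : ∀ I : Ideal (𝓞 K), absNorm I = p ^ e → ∀ P,
      (normalizedFactors I).count P < e + 1 := fun I hI P =>
    Nat.lt_succ_of_le ((Multiset.count_le_card _ _).trans (card_normalizedFactors_le K hp hI))
  have hinj : Function.Injective (fun (I : {I : Ideal (𝓞 K) // absNorm I = p ^ e}) (P : S) =>
      (⟨_, hcount I.1 I.2 P.1⟩ : Fin (e + 1))) := by
    intro I J hIJ
    have hne : ∀ I : {I : Ideal (𝓞 K) // absNorm I = p ^ e}, I.1 ≠ 0 := by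
      rintro ⟨I, hI⟩ rfl
      simp at hI
      exact absurd hI.symm (pow_ne_zero _ hp.ne_zero)
    apply Subtype.ext
    have := (UniqueFactorizationMonoid.associated_iff_normalizedFactors_eq_normalizedFactors
      (hne I) (hne J)).mpr ?_
    · exact associated_iff_eq.mp this
    · ext P
      by_cases hP : P ∈ S
      · simpa using congrFun hIJ ⟨P, hP⟩
      · rw [Multiset.count_eq_zero.mpr fun h => hP (hmem I.1 I.2 P h),
          Multiset.count_eq_zero.mpr fun h => hP (hmem J.1 J.2 P h)]
  calc idealCount K (p ^ e) ≤ Nat.card (S → Fin (e + 1)) := Nat.card_le_card_of_injective _ hinj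
    _ = (e + 1) ^ S.card := by simp
    _ ≤ _ := Nat.pow_le_pow_right (by omega) hcard

/-- The `n`-th term of the Dirichlet series of the Dedekind zeta function at a real point. -/
noncomputable def zetaTerm (s : ℝ) (n : ℕ) : ℝ :=
  if n = 0 then 0 else idealCount K n * (n : ℝ) ^ (-s)

lemma zetaTerm_nonneg (s : ℝ) (n : ℕ) : 0 ≤ zetaTerm K s n := by
  unfold zetaTerm; split_ifs <;> positivity

lemma ofReal_zetaTerm (s : ℝ) (n : ℕ) :
    ((zetaTerm K s n : ℝ) : ℂ) = LSeries.term (fun n => (idealCount K n : ℂ)) s n := by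
  unfold zetaTerm
  split_ifs with h
  · simp [h]
  · rw [LSeries.term_of_ne_zero h, Complex.ofReal_mul, Complex.ofReal_cpow (by positivity)]
    simp [Complex.cpow_neg, div_eq_mul_inv]

lemma dedekindZeta_eq_tsum_zetaTerm (s : ℝ) :
    dedekindZeta K s = ((∑' n, zetaTerm K s n : ℝ) : ℂ) := by
  rw [Complex.ofReal_tsum]
  simp_rw [ofReal_zetaTerm]
  rfl

lemma tendsto_sub_one_mul_tsum_zetaTerm :
    Tendsto (fun s : ℝ => (s - 1) * ∑' n, zetaTerm K s n) (𝓝[>] 1)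
      (𝓝 (dedekindZeta_residue K)) := by
  have h := tendsto_sub_one_mul_dedekindZeta_nhdsGT K
  simp_rw [dedekindZeta_eq_tsum_zetaTerm] at h
  have h' := (Complex.continuous_re.tendsto _).comp h
  refine h'.congr fun s => ?_
  simp only [Function.comp_apply]
  rw [← Complex.ofReal_one, ← Complex.ofReal_sub, ← Complex.ofReal_mul, Complex.ofReal_re]

lemma zetaTerm_prime_pow {p : ℕ} (hp : p.Prime) (s : ℝ) (e : ℕ) :
    zetaTerm K s (p ^ e) = idealCount K (p ^ e) * ((p : ℝ) ^ (-s)) ^ e := by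
  unfold zetaTerm
  rw [if_neg (pow_ne_zero _ hp.ne_zero)]
  congr 1
  push_cast
  rw [← Real.rpow_natCast, ← Real.rpow_natCast, ← Real.rpow_mul (by positivity),
    ← Real.rpow_mul (by positivity), mul_comm]

lemma zetaTerm_mul (s : ℝ) {m n : ℕ} (hmn : m.Coprime n) :
    zetaTerm K s (m * n) = zetaTerm K s m * zetaTerm K s n := by
  unfold zetaTerm
  by_cases hm : m = 0
  · simp [hm]
  by_cases hn : n = 0
  · simp [hn]
  rw [if_neg hm, if_neg hn, if_neg (mul_ne_zero hm hn), idealCount_mul K hmn hm hn]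
  push_cast
  rw [Real.mul_rpow (by positivity) (by positivity)]
  ring

lemma zetaTerm_one (s : ℝ) : zetaTerm K s 1 = 1 := by simp [zetaTerm, idealCount_one]

/-- Each local factor of the Dedekind zeta function is, uniformly in `s ≥ 1`, equal to
`1 + a p⁻ˢ + O(p⁻²)`, where `a` is the number of ideals of norm `p`. -/
lemma exists_bound_localFactor :
    ∃ C : ℝ, 0 ≤ C ∧ ∀ p : ℕ, p.Prime → ∀ s : ℝ, 1 ≤ s →
      1 + zetaTerm K s p ≤ ∑' e, zetaTerm K s (p ^ e) ∧
      ∑' e, zetaTerm K s (p ^ e) ≤ 1 + zetaTerm K s p + C * ((p : ℝ) ^ 2)⁻¹ := by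
  set d := Module.finrank ℤ (𝓞 K)
  have hsum : Summable fun k : ℕ => ((k + 3 : ℕ) : ℝ) ^ d * (1 / 2 : ℝ) ^ k := by
    have h := (summable_nat_add_iff 3).mpr
      (summable_pow_mul_geometric_of_norm_lt_one (R := ℝ) d (r := 1 / 2) (by norm_num))
    refine (h.mul_left 8).congr fun k => ?_
    rw [pow_add]; ring
  refine ⟨∑' k : ℕ, ((k + 3 : ℕ) : ℝ) ^ d * (1 / 2 : ℝ) ^ k, tsum_nonneg fun k => by positivity,
    fun p hp s hs => ?_⟩
  have hp2 : (2 : ℝ) ≤ p := by exact_mod_cast hp.two_le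
  have hps : (p : ℝ) ^ (-s) ≤ (p : ℝ)⁻¹ := by
    rw [← Real.rpow_neg_one]
    exact Real.rpow_le_rpow_of_exponent_le (by linarith) (by linarith)
  have hbound : ∀ k : ℕ, zetaTerm K s (p ^ (k + 2)) ≤
      ((k + 3 : ℕ) : ℝ) ^ d * (1 / 2 : ℝ) ^ k * ((p : ℝ) ^ 2)⁻¹ := by
    intro k
    rw [zetaTerm_prime_pow K hp, mul_assoc]
    refine mul_le_mul ?_ ?_ (by positivity) (by positivity)
    · exact_mod_cast idealCount_prime_pow_le K hp (k + 2)
    · calc ((p : ℝ) ^ (-s)) ^ (k + 2) ≤ ((p : ℝ)⁻¹) ^ (k + 2) :=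
            pow_le_pow_left₀ (by positivity) hps _
        _ = ((p : ℝ)⁻¹) ^ k * ((p : ℝ) ^ 2)⁻¹ := by rw [pow_add, inv_pow _ 2]
        _ ≤ _ := by
          refine mul_le_mul_of_nonneg_right (pow_le_pow_left₀ (by positivity) ?_ _) (by positivity)
          rw [one_div]
          exact inv_anti₀ (by norm_num) hp2
  have hs1 : Summable fun k : ℕ => zetaTerm K s (p ^ (k + 2)) :=
    Summable.of_nonneg_of_le (fun k => zetaTerm_nonneg K _ _) hbound (hsum.mul_right _)
  have hs0 : Summable fun e : ℕ => zetaTerm K s (p ^ e) := (summable_nat_add_iff 2).mp hs1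
  have hsplit := hs0.sum_add_tsum_nat_add 2
  simp only [Finset.sum_range_succ, Finset.sum_range_zero, pow_zero, pow_one, zero_add,
    zetaTerm_one] at hsplit
  rw [← hsplit]
  refine ⟨le_add_of_nonneg_right (tsum_nonneg fun k => zetaTerm_nonneg K _ _), ?_⟩
  gcongr
  rw [← tsum_mul_right]
  exact hs1.tsum_le_tsum hbound (hsum.mul_right _)

lemma zetaTerm_prime_le {p : ℕ} (hp : p.Prime) {s : ℝ} (hs : 1 ≤ s) :
    zetaTerm K s p ≤ 2 ^ Module.finrank ℤ (𝓞 K) * (p : ℝ)⁻¹ := by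
  have hp2 : (2 : ℝ) ≤ p := by exact_mod_cast hp.two_le
  have h := idealCount_prime_pow_le K hp 1
  rw [pow_one] at h
  unfold zetaTerm
  rw [if_neg hp.ne_zero, ← Real.rpow_neg_one]
  refine mul_le_mul (by exact_mod_cast h)
    (Real.rpow_le_rpow_of_exponent_le (by linarith) (by linarith)) (by positivity) (by positivity)

lemma summable_inv_sq_primes : Summable fun p : Nat.Primes => ((p : ℝ) ^ 2)⁻¹ := by
  have := (Real.summable_nat_pow_inv (p := 2)).mpr (by norm_num)
  exact this.comp_injective Subtype.val_injective

/-- The logarithm of the Dedekind zeta function differs by a bounded amount from the sum of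
`N(P)⁻ˢ` over the primes `P` of degree one. -/
lemma exists_abs_log_zeta_sub_le :
    ∃ C : ℝ, ∀ s : ℝ, 1 < s → Summable (zetaTerm K s) →
      |Real.log (∑' n, zetaTerm K s n) - ∑' p : Nat.Primes, zetaTerm K s p| ≤ C := by
  obtain ⟨C, hC0, hC⟩ := exists_bound_localFactor K
  set D : ℝ := 2 ^ Module.finrank ℤ (𝓞 K) + C with hD
  have hD0 : 0 ≤ D := by positivity
  refine ⟨∑' p : Nat.Primes, (C + D ^ 2) * ((p : ℝ) ^ 2)⁻¹, fun s hs hsum => ?_⟩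
  set Z : Nat.Primes → ℝ := fun p => ∑' e, zetaTerm K s (p ^ e)
  have hZ1 : ∀ p, 1 ≤ Z p := fun p =>
    le_trans (le_add_of_nonneg_right (zetaTerm_nonneg K _ _)) (hC p p.2 s hs.le).1
  have hdiff : ∀ p : Nat.Primes,
      |Real.log (Z p) - zetaTerm K s p| ≤ (C + D ^ 2) * ((p : ℝ) ^ 2)⁻¹ := by
    intro p
    obtain ⟨h1, h2⟩ := hC p p.2 s hs.le
    have hp2 : (2 : ℝ) ≤ p := by exact_mod_cast p.2.two_le
    have hlog1 : Real.log (Z p) ≤ Z p - 1 := Real.log_le_sub_one_of_pos (by linarith [hZ1 p])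
    have hlog2 : 1 - (Z p)⁻¹ ≤ Real.log (Z p) :=
      Real.one_sub_inv_le_log_of_pos (by linarith [hZ1 p])
    have hx : Z p - 1 ≤ D * (p : ℝ)⁻¹ := by
      have h3 := zetaTerm_prime_le K p.2 hs.le
      have h4 : ((p : ℝ) ^ 2)⁻¹ ≤ (p : ℝ)⁻¹ := inv_anti₀ (by linarith) (by nlinarith)
      have h5 := mul_le_mul_of_nonneg_left h4 hC0
      rw [hD, add_mul]
      linarith [h2]
    have hx0 : 0 ≤ Z p - 1 := by linarith [hZ1 p]
    have hsq : (Z p - 1) ^ 2 ≤ D ^ 2 * ((p : ℝ) ^ 2)⁻¹ := by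
      rw [← inv_pow, ← mul_pow]; exact pow_le_pow_left₀ hx0 hx 2
    -- `1 - 1 / z ≥ (z - 1) - (z - 1) ^ 2` for `z ≥ 1`
    have hinv : (Z p - 1) - (Z p - 1) ^ 2 ≤ 1 - (Z p)⁻¹ := by
      have hz : 0 < Z p := by linarith [hZ1 p]
      have : 1 - (Z p)⁻¹ - ((Z p - 1) - (Z p - 1) ^ 2) = (Z p - 1) ^ 3 * (Z p)⁻¹ := by
        field_simp; ring
      have h6 : 0 ≤ (Z p - 1) ^ 3 * (Z p)⁻¹ := by positivity
      linarith
    have hnn : 0 ≤ D ^ 2 * ((p : ℝ) ^ 2)⁻¹ := by positivity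
    have hnn' : 0 ≤ C * ((p : ℝ) ^ 2)⁻¹ := by positivity
    rw [abs_le, add_mul]
    constructor <;> linarith
  have hsq := summable_inv_sq_primes.mul_left (C + D ^ 2)
  have hδ : Summable fun p : Nat.Primes => Real.log (Z p) - zetaTerm K s p :=
    Summable.of_norm_bounded hsq hdiff
  have hy : Summable fun p : Nat.Primes => zetaTerm K s p :=
    hsum.comp_injective Subtype.val_injective
  have hlog : Summable fun p : Nat.Primes => Real.log (Z p) := by
    simpa using hδ.add hy
  have hprod := Real.rexp_tsum_eq_tprod (fun p => by linarith [hZ1 p]) hlog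
  have heuler := EulerProduct.eulerProduct_tprod (f := zetaTerm K s) (zetaTerm_one K s)
    (fun {m n} h => zetaTerm_mul K s h) hsum.norm (by simp [zetaTerm])
  rw [← heuler, ← hprod, Real.log_exp, ← hlog.tsum_sub hy]
  exact (norm_tsum_le_tsum_norm hδ.norm).trans (hδ.norm.tsum_le_tsum hdiff hsq)

lemma tendsto_neg_log_sub_one : Tendsto (fun s : ℝ => -Real.log (s - 1)) (𝓝[>] 1) atTop := by
  refine tendsto_neg_atBot_atTop.comp (Real.tendsto_log_nhdsGT_zero.comp ?_)
  rw [tendsto_nhdsWithin_iff]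
  constructor
  · have : Tendsto (fun s : ℝ => s - 1) (𝓝 1) (𝓝 (1 - 1)) := tendsto_id.sub_const 1
    rw [sub_self] at this
    exact this.mono_left nhdsWithin_le_nhds
  · filter_upwards [self_mem_nhdsWithin] with s hs
    simpa using hs

/-- The primes of degree one of a number field have Dirichlet density one, when counted by their
norms: the zeta function has a simple pole at `1`, so its logarithm is `-log (s - 1) + O(1)`. -/
theorem tendsto_tsum_zetaTerm_prime_div_log :
    Tendsto (fun s : ℝ => (∑' p : Nat.Primes, zetaTerm K s p) / (-Real.log (s - 1))) (𝓝[>] 1)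
      (𝓝 1) := by
  obtain ⟨C, hC⟩ := exists_abs_log_zeta_sub_le K
  have hres := tendsto_sub_one_mul_tsum_zetaTerm K
  have hpos := dedekindZeta_residue_pos K
  have hev : ∀ᶠ s in 𝓝[>] (1 : ℝ), 0 < (s - 1) * ∑' n, zetaTerm K s n :=
    hres.eventually_const_lt hpos
  have hlogres : Tendsto (fun s : ℝ => Real.log ((s - 1) * ∑' n, zetaTerm K s n)) (𝓝[>] 1)
      (𝓝 (Real.log (dedekindZeta_residue K))) := hres.log hpos.ne'
  have hb : ∃ B : ℝ, ∀ᶠ s in 𝓝[>] (1 : ℝ),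
      |(∑' p : Nat.Primes, zetaTerm K s p) - (-Real.log (s - 1))| ≤ B := by
    refine ⟨C + (|Real.log (dedekindZeta_residue K)| + 1), ?_⟩
    filter_upwards [hev, self_mem_nhdsWithin,
      hlogres.abs.eventually_le_const (lt_add_one _)] with s h1 hs h2
    have hs' : 0 < s - 1 := sub_pos.mpr hs
    have hz : 0 < ∑' n, zetaTerm K s n := (pos_iff_pos_of_mul_pos h1).mp hs'
    -- a divergent series would have the sum `0` by convention
    have hsum : Summable (zetaTerm K s) := by
      by_contra hns
      rw [tsum_eq_zero_of_not_summable hns] at hz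
      exact lt_irrefl _ hz
    have h3 := hC s hs hsum
    rw [Real.log_mul hs'.ne' hz.ne'] at h2
    rw [abs_le] at h2 h3 ⊢
    constructor <;> linarith [h2.1, h2.2, h3.1, h3.2]
  obtain ⟨B, hB⟩ := hb
  have h0 : Tendsto (fun s : ℝ => ((∑' p : Nat.Primes, zetaTerm K s p) - (-Real.log (s - 1))) /
      (-Real.log (s - 1))) (𝓝[>] 1) (𝓝 0) :=
    tendsto_bdd_div_atTop_nhds_zero (hB.mono fun s hs => (abs_le.mp hs).1)
      (hB.mono fun s hs => (abs_le.mp hs).2) tendsto_neg_log_sub_one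
  have h1 := h0.add_const 1
  rw [zero_add] at h1
  refine h1.congr' ?_
  filter_upwards [tendsto_neg_log_sub_one.eventually_gt_atTop 0] with s hs
  rw [sub_div, div_self hs.ne', sub_add_cancel]

end Zeta

/-! ### Roots modulo `p` and `p`-adic roots -/

section Local
open Filter

/-- Clearing denominators in a rational polynomial. -/
lemma exists_int_multiple (q : ℚ[X]) :
    ∃ (n : ℤ) (Q : ℤ[X]), n ≠ 0 ∧ Q.map (Int.castRingHom ℚ) = C (n : ℚ) * q := by
  obtain ⟨b, hb, h⟩ := IsLocalization.integerNormalization_spec (nonZeroDivisors ℤ) q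
  refine ⟨b, IsLocalization.integerNormalization (nonZeroDivisors ℤ) q,
    nonZeroDivisors.ne_zero hb, ?_⟩
  rw [← algebraMap_int_eq, h, ← Int.cast_smul_eq_zsmul ℚ, smul_eq_C_mul]

/-- A Bézout relation with integer coefficients between an irreducible polynomial and its
derivative. -/
lemma exists_bezout_derivative {F : ℤ[X]} (hF : Irreducible (F.map (Int.castRingHom ℚ))) :
    ∃ (D : ℤ) (a b : ℤ[X]), D ≠ 0 ∧ a * F + b * derivative F = C D := by
  obtain ⟨a, b, hab⟩ := hF.separable
  obtain ⟨m, A, hm, hA⟩ := exists_int_multiple a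
  obtain ⟨n, B, hn, hB⟩ := exists_int_multiple b
  refine ⟨m * n, C n * A, C m * B, mul_ne_zero hm hn, ?_⟩
  apply Polynomial.map_injective (Int.castRingHom ℚ) Int.cast_injective
  simp only [Polynomial.map_add, Polynomial.map_mul, Polynomial.map_C, hA, hB,
    Int.coe_castRingHom, ← derivative_map, C_mul]
  linear_combination (C (m : ℚ) * C (n : ℚ)) * hab

lemma eventually_not_dvd {n : ℤ} (hn : n ≠ 0) : ∀ᶠ p : ℕ in atTop, ¬ (p : ℤ) ∣ n := by
  filter_upwards [eventually_gt_atTop n.natAbs] with p hp h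
  have := Int.natAbs_dvd_natAbs.mpr h
  rw [Int.natAbs_natCast] at this
  exact absurd (Nat.le_of_dvd (Int.natAbs_pos.mpr hn) this) (not_le.mpr hp)

/-- The roots of an integer polynomial in the field with `p` elements. -/
noncomputable def modRoots (F : ℤ[X]) (p : ℕ) : Set (ZMod p) :=
  {x | (F.map (Int.castRingHom (ZMod p))).eval x = 0}

variable {p : ℕ} [Fact p.Prime]

lemma toZMod_eq_iff (x y : ℤ_[p]) : PadicInt.toZMod x = PadicInt.toZMod y ↔ ‖x - y‖ < 1 := by
  rw [← sub_eq_zero, ← map_sub, ← RingHom.mem_ker, PadicInt.ker_toZMod,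
    IsLocalRing.mem_maximalIdeal, PadicInt.mem_nonunits]

lemma toZMod_ne_zero_iff (x : ℤ_[p]) : PadicInt.toZMod x ≠ 0 ↔ ‖x‖ = 1 := by
  have := toZMod_eq_iff x 0
  rw [map_zero, sub_zero] at this
  rw [Ne, this, not_lt]
  exact ⟨fun h => le_antisymm (PadicInt.norm_le_one x) h, fun h => h.ge⟩

lemma toZMod_aeval (F : ℤ[X]) (z : ℤ_[p]) :
    PadicInt.toZMod (aeval z F) = (F.map (Int.castRingHom (ZMod p))).eval (PadicInt.toZMod z) := by
  rw [eval_map, aeval_def, hom_eval₂]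
  congr 1
  exact RingHom.ext_int _ _

/-- Hensel's lemma at a simple root modulo `p`. -/
lemma hensel_lift {F : ℤ[X]} {x : ZMod p} (hx : (F.map (Int.castRingHom (ZMod p))).eval x = 0)
    (hx' : ((derivative F).map (Int.castRingHom (ZMod p))).eval x ≠ 0) :
    ∃ z : ℤ_[p], aeval z F = 0 ∧ PadicInt.toZMod z = x ∧
      ∀ z' : ℤ_[p], aeval z' F = 0 → PadicInt.toZMod z' = x → z' = z := by
  have hcast : PadicInt.toZMod ((x.val : ℕ) : ℤ_[p]) = x := by
    rw [map_natCast, ZMod.natCast_zmod_val]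
  have h1 : ‖aeval ((x.val : ℕ) : ℤ_[p]) (derivative F)‖ = 1 := by
    rw [← toZMod_ne_zero_iff, toZMod_aeval, hcast]; exact hx'
  have h0 : ‖aeval ((x.val : ℕ) : ℤ_[p]) F‖ < 1 := by
    have := toZMod_eq_iff (aeval ((x.val : ℕ) : ℤ_[p]) F) 0
    rw [sub_zero, map_zero, toZMod_aeval, hcast] at this
    exact this.mp hx
  obtain ⟨z, hz, hz1, -, hu⟩ := hensels_lemma (F := F) (a := ((x.val : ℕ) : ℤ_[p]))
    (by rw [h1, one_pow]; exact h0)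
  rw [h1, ← toZMod_eq_iff, hcast] at hz1
  refine ⟨z, hz, hz1, fun z' hz' hz'1 => hu z' hz' ?_⟩
  rw [h1, ← toZMod_eq_iff, hcast, hz'1]

/-- A root of `F` in `ℚ_p` is integral if `p` does not divide the leading coefficient. -/
lemma exists_padicInt_eq_of_aeval_eq_zero {F : ℤ[X]} (hp : ¬ (p : ℤ) ∣ F.leadingCoeff) {z : ℚ_[p]}
    (hz : aeval z F = 0) : ∃ y : ℤ_[p], (y : ℚ_[p]) = z := by
  have hu : IsUnit (F.leadingCoeff : ℤ_[p]) := by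
    rw [PadicInt.isUnit_iff, ← toZMod_ne_zero_iff, map_intCast, Ne,
      ZMod.intCast_zmod_eq_zero_iff_dvd]
    exact hp
  obtain ⟨u, hu⟩ := hu
  have hint : IsIntegral ℤ_[p] z := by
    have hF0 : F ≠ 0 := by rintro rfl; simp at hp
    have hinj : Function.Injective (Int.castRingHom ℤ_[p]) := Int.cast_injective
    refine ⟨C ((u⁻¹ : ℤ_[p]ˣ) : ℤ_[p]) * F.map (Int.castRingHom ℤ_[p]), ?_, ?_⟩
    · rw [Monic, leadingCoeff_mul, leadingCoeff_C, leadingCoeff_map_of_injective hinj, eq_intCast,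
        ← hu, Units.inv_mul]
    · rw [eval₂_mul, eval₂_map]
      rw [aeval_def] at hz
      have : (algebraMap ℤ_[p] ℚ_[p]).comp (Int.castRingHom ℤ_[p]) = algebraMap ℤ ℚ_[p] :=
        RingHom.ext_int _ _
      rw [this, hz, mul_zero]
  exact IsIntegrallyClosed.isIntegral_iff.mp hint

/-- The field `K` embeds into the field of `p`-adic numbers; for a Galois extension of `ℚ` this
is a form of saying that `p` splits completely. -/
def EmbedsPadic (p : ℕ) [Fact p.Prime] (K : Type*) [Field K] : Prop := Nonempty (K →+* ℚ_[p])

lemma exists_hom_of_aeval_minpoly {k K E : Type*} [Field k] [Field K] [Field E] [Algebra k K]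
    [Algebra k E] {α : K} (hα : IsIntegral k α) (htop : k⟮α⟯ = ⊤) {z : E}
    (hz : aeval z (minpoly k α) = 0) : ∃ φ : K →ₐ[k] E, φ α = z := by
  let e := ((equivOfEq htop).trans topEquiv).symm
  refine ⟨((algHomAdjoinIntegralEquiv k hα).symm ⟨z, mem_aroots.mpr ⟨minpoly.ne_zero hα, hz⟩⟩).comp
    (e : K →ₐ[k] k⟮α⟯), ?_⟩
  have : (e : K →ₐ[k] k⟮α⟯) α = AdjoinSimple.gen k α := by
    apply Subtype.ext
    rfl
  rw [AlgHom.comp_apply, this, algHomAdjoinIntegralEquiv_symm_apply_gen]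

lemma aeval_minpoly_eq_zero {K E : Type*} [Field K] [Field E] [Algebra ℚ K] [Algebra ℚ E] {F : ℤ[X]}
    (hF : Irreducible (F.map (Int.castRingHom ℚ))) {α : K} (hα : aeval α F = 0) {z : E}
    (hz : aeval z F = 0) : aeval z (minpoly ℚ α) = 0 := by
  have hα' : aeval α (F.map (Int.castRingHom ℚ)) = 0 := by
    rw [← algebraMap_int_eq, aeval_map_algebraMap, hα]
  have hz' : aeval z (F.map (Int.castRingHom ℚ)) = 0 := by
    rw [← algebraMap_int_eq, aeval_map_algebraMap, hz]
  have h := minpoly.eq_of_irreducible hF hα'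
  rw [← h, map_mul, hz', zero_mul]

lemma splits_padic_of_embedsPadic {K : Type*} [Field K] [Algebra ℚ K] [Normal ℚ K]
    (h : EmbedsPadic p K) (x : K) : ((minpoly ℚ x).map (algebraMap ℚ ℚ_[p])).Splits := by
  obtain ⟨φ⟩ := h
  have := (Normal.splits (F := ℚ) inferInstance x).map φ
  rw [Polynomial.map_map] at this
  have h2 : φ.comp (algebraMap ℚ K) = algebraMap ℚ ℚ_[p] := RingHom.ext_rat _ _
  rwa [h2] at this

lemma bezout_eval {F a b : ℤ[X]} {D : ℤ} (hab : a * F + b * derivative F = C D)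
    (hD : ¬ (p : ℤ) ∣ D) {x : ZMod p} (hx : (F.map (Int.castRingHom (ZMod p))).eval x = 0) :
    ((derivative F).map (Int.castRingHom (ZMod p))).eval x ≠ 0 := by
  intro h
  have := congrArg (fun q : ℤ[X] => (q.map (Int.castRingHom (ZMod p))).eval x) hab
  simp only [Polynomial.map_add, Polynomial.map_mul, eval_add, eval_mul, hx, h, mul_zero, add_zero,
    Polynomial.map_C, eval_C, Int.coe_castRingHom] at this
  exact hD ((ZMod.intCast_zmod_eq_zero_iff_dvd _ _).mp this.symm)

end Local

section RootCount
open Filter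

/-- For all but finitely many primes, the roots modulo `p` of an irreducible polynomial `F` are
simple. -/
lemma eventually_simple_roots {F : ℤ[X]} (hF : Irreducible (F.map (Int.castRingHom ℚ))) :
    ∀ᶠ p : ℕ in atTop, ∀ _ : Fact p.Prime, ∀ x ∈ modRoots F p,
      ((derivative F).map (Int.castRingHom (ZMod p))).eval x ≠ 0 := by
  obtain ⟨D, a, b, hD, hab⟩ := exists_bezout_derivative hF
  filter_upwards [eventually_not_dvd hD] with p hp _ x hx
  exact bezout_eval hab hp hx

/-- For all but finitely many primes `p`, an irreducible polynomial `F` one of whose roots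
generates a normal extension `K` splits modulo `p` if `K` embeds into `ℚ_p`, and has no root modulo
`p` otherwise. -/
theorem eventually_ncard_modRoots {F : ℤ[X]} (hF : Irreducible (F.map (Int.castRingHom ℚ)))
    {K : Type*} [Field K] [Algebra ℚ K] [Normal ℚ K] {α : K} (hα : aeval α F = 0)
    (htop : ℚ⟮α⟯ = ⊤) :
    ∀ᶠ p : ℕ in atTop, ∀ _ : Fact p.Prime,
      (EmbedsPadic p K → (modRoots F p).ncard = F.natDegree) ∧
      (¬ EmbedsPadic p K → modRoots F p = ∅) := by
  have hF0 : F ≠ 0 := by rintro rfl; simp at hF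
  have hint : IsIntegral ℚ α := Algebra.IsIntegral.isIntegral α
  filter_upwards [eventually_simple_roots hF,
    eventually_not_dvd (leadingCoeff_ne_zero.mpr hF0)] with p hsimple hlead _
  classical
  constructor
  · -- `F` splits over `ℚ_p` with integral roots, and these are determined by their residues
    intro hK
    have hsplit := splits_padic_of_embedsPadic hK α
    have hassoc : F.map (Int.castRingHom ℚ) =
        C (F.map (Int.castRingHom ℚ)).leadingCoeff * minpoly ℚ α := by
      have hα' : aeval α (F.map (Int.castRingHom ℚ)) = 0 := by
        rw [← algebraMap_int_eq, aeval_map_algebraMap, hα]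
      rw [← minpoly.eq_of_irreducible hF hα', mul_left_comm, ← C_mul,
        mul_inv_cancel₀ (leadingCoeff_ne_zero.mpr hF.ne_zero), C_1, mul_one]
    have hsplitF : (F.map (Int.castRingHom ℚ_[p])).Splits := by
      have h2 : F.map (Int.castRingHom ℚ_[p]) =
          (F.map (Int.castRingHom ℚ)).map (algebraMap ℚ ℚ_[p]) := by
        rw [Polynomial.map_map]; congr 1
      rw [h2, hassoc, Polynomial.map_mul, Polynomial.map_C]
      exact hsplit.C_mul _
    have hsep : (F.map (Int.castRingHom ℚ_[p])).Separable := by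
      have h2 : F.map (Int.castRingHom ℚ_[p]) =
          (F.map (Int.castRingHom ℚ)).map (algebraMap ℚ ℚ_[p]) := by
        rw [Polynomial.map_map]; congr 1
      rw [h2]
      exact hF.separable.map
    have hcard : ((F.map (Int.castRingHom ℚ_[p])).roots.toFinset).card = F.natDegree := by
      rw [Multiset.toFinset_card_of_nodup (nodup_roots hsep), ← hsplitF.natDegree_eq_card_roots,
        natDegree_map_eq_of_injective Int.cast_injective]
    have hroot : ∀ z ∈ (F.map (Int.castRingHom ℚ_[p])).roots.toFinset, aeval z F = 0 := by
      intro z hz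
      rw [Multiset.mem_toFinset, mem_roots', IsRoot.def, eval_map] at hz
      rw [aeval_def, algebraMap_int_eq]
      exact hz.2
    have hcoe : ∀ z : ℤ_[p], aeval (z : ℚ_[p]) F = 0 → aeval z F = 0 := by
      intro z hz
      have : aeval (algebraMap ℤ_[p] ℚ_[p] z) F = 0 := hz
      rw [aeval_algebraMap_apply] at this
      exact (map_eq_zero_iff _ (IsFractionRing.injective ℤ_[p] ℚ_[p])).mp this
    choose! y hy using fun (z : ℚ_[p]) (hz : aeval z F = 0) =>
      exists_padicInt_eq_of_aeval_eq_zero hlead hz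
    have hy0 : ∀ z, aeval z F = 0 → aeval (y z) F = 0 := fun z hz =>
      hcoe _ (by rw [hy z hz, hz])
    have hymod : ∀ z, aeval z F = 0 → PadicInt.toZMod (y z) ∈ modRoots F p := by
      intro z hz
      change eval _ _ = 0
      rw [← toZMod_aeval, hy0 z hz, map_zero]
    apply le_antisymm
    · have hne : F.map (Int.castRingHom (ZMod p)) ≠ 0 := by
        intro h
        have := congrArg (fun q => coeff q F.natDegree) h
        simp only [coeff_map, coeff_natDegree, eq_intCast, coeff_zero] at this
        exact hlead ((ZMod.intCast_zmod_eq_zero_iff_dvd _ _).mp this)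
      have hsub : modRoots F p ⊆
          ((F.map (Int.castRingHom (ZMod p))).roots.toFinset : Set (ZMod p)) := by
        intro x hx
        simp only [Finset.mem_coe, Multiset.mem_toFinset]
        exact (mem_roots hne).mpr hx
      calc (modRoots F p).ncard
          ≤ ((F.map (Int.castRingHom (ZMod p))).roots.toFinset : Set (ZMod p)).ncard :=
            Set.ncard_le_ncard hsub (Finset.finite_toSet _)
        _ = _ := Set.ncard_coe_finset _
        _ ≤ _ := Multiset.toFinset_card_le _
        _ ≤ _ := card_roots' _
        _ ≤ _ := natDegree_map_le
    · rw [← hcard, ← Set.ncard_coe_finset]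
      refine Set.ncard_le_ncard_of_injOn (fun z : ℚ_[p] => PadicInt.toZMod (y z))
        (fun z hz => hymod z (hroot z hz)) ?_ (Set.toFinite _)
      intro z hz w hw hzw
      have hz0 := hroot z hz
      have hw0 := hroot w hw
      have hx := hymod z hz0
      obtain ⟨v, -, -, hv⟩ := hensel_lift hx (hsimple _ _ hx)
      rw [← hy z hz0, ← hy w hw0, hv _ (hy0 z hz0) rfl, hv _ (hy0 w hw0) hzw.symm]
  · -- a root modulo `p` would lift to `ℤ_p`, which defines an embedding of `K`
    intro hK
    rw [Set.eq_empty_iff_forall_notMem]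
    intro x hx
    obtain ⟨z, hz, -, -⟩ := hensel_lift hx (hsimple _ _ hx)
    have hz' : aeval (z : ℚ_[p]) F = 0 := by
      change aeval (algebraMap ℤ_[p] ℚ_[p] z) F = 0
      rw [aeval_algebraMap_apply, hz, map_zero]
    obtain ⟨φ, -⟩ := exists_hom_of_aeval_minpoly hint htop (aeval_minpoly_eq_zero hF hα hz')
    exact hK ⟨φ.toRingHom⟩

end RootCount

/-! ### Ideals of prime norm -/

section Homs
open NumberField Filter Topology

variable (K : Type*) [Field K] [NumberField K]

/-- Ideals of prime norm `p` are the kernels of the ring homomorphisms to the field with `p`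
elements. -/
lemma idealCount_eq_card_ringHom (p : ℕ) [Fact p.Prime] :
    idealCount K p = Nat.card (𝓞 K →+* ZMod p) := by
  symm
  refine Nat.card_eq_of_bijective
    (fun φ : 𝓞 K →+* ZMod p => (⟨RingHom.ker φ, ?_⟩ : {I : Ideal (𝓞 K) // Ideal.absNorm I = p}))
    ⟨?_, ?_⟩
  · rw [Ideal.absNorm_apply, Submodule.cardQuot_apply,
      Nat.card_congr (RingHom.quotientKerEquivOfSurjective
        (ZMod.ringHom_surjective φ)).toEquiv, Nat.card_zmod]
  · intro φ ψ h
    have hker : RingHom.ker φ = RingHom.ker ψ := congrArg Subtype.val h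
    ext x
    obtain ⟨n, hn⟩ := ZMod.intCast_surjective (φ x)
    have h1 : x - (n : 𝓞 K) ∈ RingHom.ker φ := by
      rw [RingHom.mem_ker, map_sub, map_intCast, hn, sub_self]
    rw [hker, RingHom.mem_ker, map_sub, map_intCast, hn, sub_eq_zero] at h1
    exact h1.symm
  · rintro ⟨I, hI⟩
    have hcard : Nat.card (𝓞 K ⧸ I) = p := by
      rw [← hI, Ideal.absNorm_apply, Submodule.cardQuot_apply]
    have hp : p.Prime := Fact.out
    have : Finite (𝓞 K ⧸ I) := Nat.finite_of_card_ne_zero (by rw [hcard]; exact hp.ne_zero)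
    have := Fintype.ofFinite (𝓞 K ⧸ I)
    let e := ZMod.ringEquivOfPrime (𝓞 K ⧸ I) hp (by rw [← Nat.card_eq_fintype_card, hcard])
    refine ⟨(e.symm : (𝓞 K ⧸ I) →+* ZMod p).comp (Ideal.Quotient.mk I), Subtype.ext ?_⟩
    ext x
    simp only [RingHom.mem_ker, RingHom.comp_apply, RingHom.coe_coe]
    rw [EmbeddingLike.map_eq_zero_iff, Ideal.Quotient.eq_zero_iff_mem]

/-- The maximal order has a primitive element for the field. -/
lemma exists_integral_primitive_element : ∃ θ : 𝓞 K, ℚ⟮(θ : K)⟯ = ⊤ := by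
  obtain ⟨α, hα⟩ := Field.exists_primitive_element ℚ K
  obtain ⟨n, hn, hint⟩ := exists_integral_multiples ℤ ℚ ({α} : Finset K)
  have hθ := hint α (Finset.mem_singleton_self α)
  refine ⟨⟨n • α, hθ⟩, ?_⟩
  rw [eq_top_iff, ← hα, adjoin_simple_le_iff]
  have h1 : (n • α : K) ∈ ℚ⟮(n • α : K)⟯ := mem_adjoin_simple_self ℚ _
  have h2 : ((n : ℚ)⁻¹) • (n • α : K) = α := by
    rw [← Int.cast_smul_eq_zsmul ℚ, smul_smul, inv_mul_cancel₀ (by exact_mod_cast hn), one_smul]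
  have h3 := (ℚ⟮(n • α : K)⟯).smul_mem h1 (x := (n : ℚ)⁻¹)
  rw [h2] at h3
  exact h3

/-- An embedding of `K` into `ℚ_p` maps integers to `p`-adic integers. -/
lemma exists_integral_restrict {p : ℕ} [Fact p.Prime] (φ : K →+* ℚ_[p]) :
    ∃ ψ : 𝓞 K →+* ℤ_[p], ∀ x, (ψ x : ℚ_[p]) = φ x := by
  have h : ∀ x : 𝓞 K, ∃ y : ℤ_[p], (y : ℚ_[p]) = φ x := by
    intro x
    have h1 : IsIntegral ℤ (φ (x : K)) := x.isIntegral_coe.map (φ.toIntAlgHom)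
    exact IsIntegrallyClosed.isIntegral_iff.mp (h1.tower_top (A := ℤ_[p]))
  choose y hy using h
  refine ⟨{ toFun := y, map_one' := ?_, map_mul' := ?_, map_zero' := ?_, map_add' := ?_ }, hy⟩
  · apply PadicInt.ext; simp [hy]
  · intro a b; apply PadicInt.ext; simp [hy]
  · apply PadicInt.ext; simp [hy]
  · intro a b; apply PadicInt.ext; simp [hy]

/-- For all but finitely many primes `p`, the ideals of norm `p` correspond to the roots modulo
`p` of the minimal polynomial of an integral primitive element. -/
lemma eventually_idealCount_eq_ncard {θ : 𝓞 K} (hθ : ℚ⟮(θ : K)⟯ = ⊤) {F : ℤ[X]}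
    (hF : Irreducible (F.map (Int.castRingHom ℚ))) (hFθ : aeval (θ : K) F = 0) :
    ∀ᶠ p : ℕ in atTop, ∀ _ : Fact p.Prime, idealCount K p = (modRoots F p).ncard := by
  have hint : IsIntegral ℚ (θ : K) := Algebra.IsIntegral.isIntegral _
  have hFθ' : aeval θ F = 0 := by
    have : aeval (algebraMap (𝓞 K) K θ) F = 0 := hFθ
    rw [aeval_algebraMap_apply] at this
    exact (map_eq_zero_iff _ (IsFractionRing.injective (𝓞 K) K)).mp this
  set b := RingOfIntegers.basis K
  -- up to finitely many primes, a homomorphism is determined by the image of `θ`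
  have hden : ∀ i, ∃ (n : ℤ) (Q : ℤ[X]), n ≠ 0 ∧ (n : 𝓞 K) * b i = aeval θ Q := by
    intro i
    have h1 : (b i : K) ∈ ℚ⟮(θ : K)⟯ := by rw [hθ]; trivial
    rw [← IntermediateField.mem_toSubalgebra,
      adjoin_simple_toSubalgebra_of_isAlgebraic hint.isAlgebraic] at h1
    obtain ⟨q, hq⟩ := Algebra.adjoin_singleton_eq_range_aeval ℚ (θ : K) ▸ h1
    obtain ⟨n, Q, hn, hQ⟩ := exists_int_multiple q
    refine ⟨n, Q, hn, ?_⟩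
    apply IsFractionRing.injective (𝓞 K) K
    rw [map_mul, map_intCast, ← aeval_algebraMap_apply]
    have h2 := congrArg (aeval (θ : K)) hQ
    rw [← algebraMap_int_eq, aeval_map_algebraMap, map_mul, aeval_C] at h2
    change _ = aeval (θ : K) Q
    rw [h2]
    change _ = _ * (aeval (θ : K)).toRingHom q
    rw [hq]
    simp
  choose n Q hn hQ using hden
  have hnd : ∀ᶠ p : ℕ in atTop, ∀ i, ¬ (p : ℤ) ∣ n i :=
    eventually_all.mpr fun i => eventually_not_dvd (hn i)
  filter_upwards [hnd, eventually_simple_roots hF] with p hp hsimple _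
  rw [idealCount_eq_card_ringHom, ← Nat.card_coe_set_eq]
  refine Nat.card_eq_of_bijective (fun φ : 𝓞 K →+* ZMod p => (⟨φ θ, ?_⟩ : modRoots F p)) ⟨?_, ?_⟩
  · change eval _ _ = 0
    rw [eval_map, ← RingHom.ext_int (φ.comp (algebraMap ℤ (𝓞 K))) (Int.castRingHom (ZMod p)),
      ← hom_eval₂, ← aeval_def, hFθ', map_zero]
  · intro φ ψ h
    have h0 : φ θ = ψ θ := congrArg Subtype.val h
    have hpoly : ∀ q : ℤ[X], φ (aeval θ q) = ψ (aeval θ q) := by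
      intro q
      rw [aeval_def, hom_eval₂, hom_eval₂, h0]
      congr 1
      exact RingHom.ext_int _ _
    have hb : ∀ i, φ (b i) = ψ (b i) := by
      intro i
      have h1 := hpoly (Q i)
      rw [← hQ, map_mul, map_mul, map_intCast, map_intCast] at h1
      refine mul_left_cancel₀ ?_ h1
      rw [Ne, ZMod.intCast_zmod_eq_zero_iff_dvd]
      exact hp i
    have hadd : φ.toAddMonoidHom.toIntLinearMap = ψ.toAddMonoidHom.toIntLinearMap :=
      b.ext hb
    ext x
    exact congrArg (fun f => f x) hadd
  · -- a root lifts to `ℤ_p`, which gives an embedding into `ℚ_p` and, by reduction, a homomorphism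
    rintro ⟨x, hx⟩
    obtain ⟨z, hz, hzx, -⟩ := hensel_lift hx (hsimple _ _ hx)
    have hz' : aeval (z : ℚ_[p]) F = 0 := by
      change aeval (algebraMap ℤ_[p] ℚ_[p] z) F = 0
      rw [aeval_algebraMap_apply, hz, map_zero]
    obtain ⟨φ, hφ⟩ := exists_hom_of_aeval_minpoly hint hθ (aeval_minpoly_eq_zero hF hFθ hz')
    obtain ⟨ψ, hψ⟩ := exists_integral_restrict K φ.toRingHom
    refine ⟨PadicInt.toZMod.comp ψ, Subtype.ext ?_⟩
    have : ψ θ = z := PadicInt.ext (by rw [hψ]; exact hφ)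
    simp [this, hzx]

/-- For all but finitely many primes `p`, a Galois number field `K` has `[K : ℚ]` ideals of norm `p`
if it embeds into `ℚ_p`, and none otherwise. -/
theorem eventually_idealCount_eq [Normal ℚ K] :
    ∀ᶠ p : ℕ in atTop, ∀ _ : Fact p.Prime,
      (EmbedsPadic p K → idealCount K p = Module.finrank ℚ K) ∧
      (¬ EmbedsPadic p K → idealCount K p = 0) := by
  obtain ⟨θ, hθ⟩ := exists_integral_primitive_element K
  have hmin := minpoly.isIntegrallyClosed_eq_field_fractions ℚ K (RingOfIntegers.isIntegral θ)
  rw [algebraMap_int_eq] at hmin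
  have hF : Irreducible ((minpoly ℤ θ).map (Int.castRingHom ℚ)) := by
    rw [← hmin]
    exact minpoly.irreducible (Algebra.IsIntegral.isIntegral _)
  have hFθ : aeval (θ : K) (minpoly ℤ θ) = 0 := by
    change aeval (algebraMap (𝓞 K) K θ) _ = 0
    rw [aeval_algebraMap_apply, minpoly.aeval, map_zero]
  have hdeg : (minpoly ℤ θ).natDegree = Module.finrank ℚ K := by
    rw [← natDegree_map_eq_of_injective (f := Int.castRingHom ℚ) Int.cast_injective, ← hmin,
      ← adjoin.finrank (Algebra.IsIntegral.isIntegral _)]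
    change Module.finrank ℚ ℚ⟮(θ : K)⟯ = _
    rw [hθ, finrank_top']
  filter_upwards [eventually_idealCount_eq_ncard K hθ hF hFθ,
    eventually_ncard_modRoots hF hFθ hθ] with p h1 h2 hp
  rw [h1 hp, ← hdeg]
  exact ⟨(h2 _).1, fun h => by rw [(h2 _).2 h, Set.ncard_empty]⟩

end Homs

/-! ### Dirichlet means over the primes -/

section Density
open NumberField Filter Topology

/-- A bounded function `c` on the primes has Dirichlet mean `δ`: the sum of `c(p) p⁻ˢ` over all
primes is asymptotic to `δ log (1 / (s - 1))` as `s` decreases to `1`. -/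
structure HasPrimeMean (c : Nat.Primes → ℝ) (δ : ℝ) : Prop where
  bounded : ∃ M : ℝ, ∀ p, |c p| ≤ M
  tendsto : Tendsto (fun s : ℝ => (∑' p : Nat.Primes, c p * (p : ℝ) ^ (-s)) / (-Real.log (s - 1)))
    (𝓝[>] 1) (𝓝 δ)

lemma summable_mul_rpow {c : Nat.Primes → ℝ} (hc : ∃ M : ℝ, ∀ p, |c p| ≤ M) {s : ℝ} (hs : 1 < s) :
    Summable fun p : Nat.Primes => c p * (p : ℝ) ^ (-s) := by
  obtain ⟨M, hM⟩ := hc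
  refine Summable.of_norm_bounded
    ((Nat.Primes.summable_rpow (r := -s).mpr (by linarith)).mul_left M) fun p => ?_
  rw [norm_mul, Real.norm_eq_abs, Real.norm_of_nonneg (by positivity)]
  exact mul_le_mul_of_nonneg_right (hM p) (by positivity)

namespace HasPrimeMean

lemma const_mul {c : Nat.Primes → ℝ} {δ : ℝ} (h : HasPrimeMean c δ) (a : ℝ) :
    HasPrimeMean (fun p => a * c p) (a * δ) := by
  obtain ⟨M, hM⟩ := h.bounded
  refine ⟨⟨|a| * M, fun p => ?_⟩, ?_⟩
  · rw [abs_mul]; exact mul_le_mul_of_nonneg_left (hM p) (abs_nonneg _)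
  · refine (h.tendsto.const_mul a).congr fun s => ?_
    simp_rw [mul_assoc, tsum_mul_left, mul_div_assoc]

lemma add {c c' : Nat.Primes → ℝ} {δ δ' : ℝ} (h : HasPrimeMean c δ) (h' : HasPrimeMean c' δ') :
    HasPrimeMean (fun p => c p + c' p) (δ + δ') := by
  obtain ⟨M, hM⟩ := h.bounded
  obtain ⟨M', hM'⟩ := h'.bounded
  refine ⟨⟨M + M', fun p => (abs_add_le _ _).trans (add_le_add (hM p) (hM' p))⟩, ?_⟩
  refine (h.tendsto.add h'.tendsto).congr' ?_
  filter_upwards [self_mem_nhdsWithin] with s hs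
  rw [← add_div, ← (summable_mul_rpow h.bounded hs).tsum_add (summable_mul_rpow h'.bounded hs)]
  simp_rw [add_mul]

lemma zero_of_eventually {c : Nat.Primes → ℝ} {B : ℕ} (h : ∀ p : Nat.Primes, B ≤ p → c p = 0) :
    HasPrimeMean c 0 := by
  have hfin : {p : Nat.Primes | (p : ℕ) < B}.Finite :=
    (Set.finite_lt_nat B).preimage Subtype.val_injective.injOn
  have hsupp : ∀ p ∉ hfin.toFinset, c p = 0 := fun p hp => h p (by simpa using hp)
  have hb : ∀ p, |c p| ≤ ∑ q ∈ hfin.toFinset, |c q| := by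
    intro p
    by_cases hp : p ∈ hfin.toFinset
    · exact Finset.single_le_sum (f := fun q => |c q|) (fun q _ => abs_nonneg _) hp
    · rw [hsupp p hp, abs_zero]; exact Finset.sum_nonneg fun q _ => abs_nonneg _
  refine ⟨⟨_, hb⟩, ?_⟩
  have hbound : ∀ᶠ s in 𝓝[>] (1 : ℝ),
      |∑' p : Nat.Primes, c p * (p : ℝ) ^ (-s)| ≤ ∑ q ∈ hfin.toFinset, |c q| := by
    filter_upwards [self_mem_nhdsWithin] with s hs
    rw [tsum_eq_sum (s := hfin.toFinset) fun p hp => by rw [hsupp p hp, zero_mul]]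
    refine (Finset.abs_sum_le_sum_abs _ _).trans (Finset.sum_le_sum fun p _ => ?_)
    rw [abs_mul, abs_of_nonneg (by positivity : (0 : ℝ) ≤ (p : ℝ) ^ (-s))]
    refine mul_le_of_le_one_right (abs_nonneg _) ?_
    refine Real.rpow_le_one_of_one_le_of_nonpos (by exact_mod_cast p.2.one_lt.le) ?_
    have : (1 : ℝ) < s := hs
    linarith
  exact tendsto_bdd_div_atTop_nhds_zero (hbound.mono fun s hs => (abs_le.mp hs).1)
    (hbound.mono fun s hs => (abs_le.mp hs).2) tendsto_neg_log_sub_one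

lemma congr_of_eventually {c c' : Nat.Primes → ℝ} {δ : ℝ} (h : HasPrimeMean c δ) {B : ℕ}
    (hcc' : ∀ p : Nat.Primes, B ≤ p → c p = c' p) : HasPrimeMean c' δ := by
  have h0 : HasPrimeMean (fun p => c' p - c p) 0 :=
    zero_of_eventually (B := B) fun p hp => by rw [hcc' p hp, sub_self]
  simpa using h.add h0

lemma sum {ι : Type*} (S : Finset ι) {c : ι → Nat.Primes → ℝ} {δ : ι → ℝ}
    (h : ∀ i ∈ S, HasPrimeMean (c i) (δ i)) :
    HasPrimeMean (fun p => ∑ i ∈ S, c i p) (∑ i ∈ S, δ i) := by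
  classical
  induction S using Finset.induction_on with
  | empty => simpa using zero_of_eventually (c := fun _ => 0) (B := 0) (by simp)
  | insert a S ha ih =>
    simp_rw [Finset.sum_insert ha]
    exact (h a (Finset.mem_insert_self a S)).add
      (ih fun i hi => h i (Finset.mem_insert_of_mem hi))

lemma unique {c : Nat.Primes → ℝ} {δ δ' : ℝ} (h : HasPrimeMean c δ) (h' : HasPrimeMean c δ') :
    δ = δ' := tendsto_nhds_unique h.tendsto h'.tendsto

end HasPrimeMean

open Classical in
/-- The indicator function of the primes `p` such that `K` embeds into `ℚ_p`. -/
noncomputable def padicIndicator (K : Type*) [Field K] (p : Nat.Primes) : ℝ :=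
  haveI : Fact (p : ℕ).Prime := ⟨p.2⟩
  if EmbedsPadic p K then 1 else 0

/-- The primes `p` such that a Galois number field `K` embeds into `ℚ_p`, that is, up to finitely
many exceptions the primes that split completely in `K`, have density `1 / [K : ℚ]`. -/
theorem hasPrimeMean_padicIndicator (K : Type*) [Field K] [NumberField K] [Normal ℚ K] :
    HasPrimeMean (padicIndicator K) (Module.finrank ℚ K : ℝ)⁻¹ := by
  obtain ⟨B, hB⟩ := eventually_atTop.mp (eventually_idealCount_eq K)
  have hd : (Module.finrank ℚ K : ℝ) ≠ 0 := by
    exact_mod_cast (Module.finrank_pos (R := ℚ) (M := K)).ne'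
  have h1 : HasPrimeMean (fun p : Nat.Primes => (idealCount K p : ℝ)) 1 := by
    refine ⟨⟨2 ^ Module.finrank ℤ (𝓞 K), fun p => ?_⟩, ?_⟩
    · have h := idealCount_prime_pow_le K p.2 1
      rw [pow_one] at h
      rw [abs_of_nonneg (by positivity)]
      exact_mod_cast h
    · refine (tendsto_tsum_zetaTerm_prime_div_log K).congr fun s => ?_
      congr 1
      refine tsum_congr fun p => ?_
      rw [zetaTerm, if_neg p.2.ne_zero]
  have h2 := h1.const_mul (Module.finrank ℚ K : ℝ)⁻¹
  rw [mul_one] at h2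
  refine h2.congr_of_eventually (B := B) fun p hp => ?_
  obtain ⟨h3, h4⟩ := hB p hp ⟨p.2⟩
  unfold padicIndicator
  split_ifs with h
  · rw [h3 h, inv_mul_cancel₀ hd]
  · rw [h4 h, Nat.cast_zero, mul_zero]

/-- The compositum of two normal extensions embeds into `ℚ_p` when both do. -/
lemma padicIndicator_sup {L : Type*} [Field L] [NumberField L] (K K' : IntermediateField ℚ L)
    [Normal ℚ K] [Normal ℚ K'] (p : Nat.Primes) :
    padicIndicator (K ⊔ K' : IntermediateField ℚ L) p =
      padicIndicator K p * padicIndicator K' p := by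
  have : Fact (p : ℕ).Prime := ⟨p.2⟩
  have key : EmbedsPadic p (K ⊔ K' : IntermediateField ℚ L) ↔
      EmbedsPadic p K ∧ EmbedsPadic p K' := by
    constructor
    · rintro ⟨φ⟩
      exact ⟨⟨φ.comp (inclusion (le_sup_left : K ≤ K ⊔ K')).toRingHom⟩,
        ⟨φ.comp (inclusion (le_sup_right : K' ≤ K ⊔ K')).toRingHom⟩⟩
    · rintro ⟨h, h'⟩
      have hsup : K ⊔ K' = adjoin ℚ ((K : Set L) ∪ K') := by
        rw [adjoin_union, adjoin_self, adjoin_self]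
      rw [hsup]
      obtain ⟨φ⟩ := nonempty_algHom_adjoin_of_splits (F := ℚ) (E := L) (K := ℚ_[p])
        (S := (K : Set L) ∪ K') (by
          rintro s (hs | hs)
          · refine ⟨Algebra.IsIntegral.isIntegral s, ?_⟩
            have := splits_padic_of_embedsPadic h (⟨s, hs⟩ : K)
            rwa [← minpoly_eq (⟨s, hs⟩ : K)]
          · refine ⟨Algebra.IsIntegral.isIntegral s, ?_⟩
            have := splits_padic_of_embedsPadic h' (⟨s, hs⟩ : K')
            rwa [← minpoly_eq (⟨s, hs⟩ : K')])
      exact ⟨φ.toRingHom⟩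
  unfold padicIndicator
  split_ifs <;> simp_all

end Density

/-! ### Linear independence of the indicators of Galois fields -/

section Independence
open NumberField

variable {L : Type*} [Field L] [NumberField L]

/-- Normality over `ℚ` does not depend on the algebra structure, of which there is only one up to
propositional equality. -/
lemma normal_of_normal_algebra {k : Type*} [Field k] {i j : Algebra ℚ k}
    (h : @Normal ℚ k _ _ i) : @Normal ℚ k _ _ j := by rwa [Subsingleton.elim j i]

omit [NumberField L] in
lemma normal_sup_rat [CharZero L] (K K' : IntermediateField ℚ L) (hK : Normal ℚ K)
    (hK' : Normal ℚ K') : Normal ℚ (K ⊔ K' : IntermediateField ℚ L) := by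
  have h1 := normal_of_normal_algebra (j := K.algebra') hK
  have h2 := normal_of_normal_algebra (j := K'.algebra') hK'
  exact normal_of_normal_algebra (IntermediateField.normal_sup ℚ L K K')

/-- If a linear combination of the indicator functions of Galois fields vanishes at almost all
primes, then its inner product with each such function vanishes. -/
lemma sum_div_finrank_sup_eq_zero {c : IntermediateField ℚ L → ℝ}
    {S : Finset (IntermediateField ℚ L)}
    (hS : ∀ K ∈ S, Normal ℚ K) {B : ℕ}
    (h : ∀ p : Nat.Primes, B ≤ p → ∑ K ∈ S, c K * padicIndicator K p = 0)
    (K' : IntermediateField ℚ L) [Normal ℚ K'] :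
    ∑ K ∈ S, c K * (Module.finrank ℚ (K ⊔ K' : IntermediateField ℚ L) : ℝ)⁻¹ = 0 := by
  have h1 := HasPrimeMean.sum S
    (c := fun K p => c K * padicIndicator (K ⊔ K' : IntermediateField ℚ L) p)
    (δ := fun K => c K * (Module.finrank ℚ (K ⊔ K' : IntermediateField ℚ L) : ℝ)⁻¹) fun K hK => by
      have := normal_sup_rat K K' (hS K hK) inferInstance
      exact (hasPrimeMean_padicIndicator (K ⊔ K' : IntermediateField ℚ L)).const_mul _
  refine h1.unique (HasPrimeMean.zero_of_eventually (B := B) fun p hp => ?_)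
  rw [Finset.sum_congr rfl (g := fun K => c K * padicIndicator K p * padicIndicator K' p)
    fun K hK => by
      have := hS K hK
      rw [padicIndicator_sup, mul_assoc], ← Finset.sum_mul, h p hp, zero_mul]

/-- Linear independence for fields of degree at most two: the compositum of two quadratic fields has
degree four unless they are equal, so the inner product with the indicator of `K₀` minus half of
that with the indicator of `ℚ` is `c K₀ / 4`. -/
lemma eq_zero_of_finrank_le_two {c : IntermediateField ℚ L → ℝ}
    {S : Finset (IntermediateField ℚ L)} (hdeg : ∀ K ∈ S, Module.finrank ℚ K ≤ 2)
    (hS : ∀ K ∈ S, Normal ℚ K) {B : ℕ}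
    (h : ∀ p : Nat.Primes, B ≤ p → ∑ K ∈ S, c K * padicIndicator K p = 0) :
    ∀ K ∈ S, c K = 0 := by
  classical
  have hrow := sum_div_finrank_sup_eq_zero hS h
  have hT : ∑ K ∈ S, c K * (Module.finrank ℚ K : ℝ)⁻¹ = 0 := by
    have hbot : Normal ℚ (⊥ : IntermediateField ℚ L) :=
      normal_of_normal_algebra (Normal.of_algEquiv (botEquiv ℚ L).symm)
    exact (Finset.sum_congr rfl fun K _ => by rw [sup_bot_eq]).trans (hrow ⊥)
  have h2 : ∀ K₀ ∈ S, Module.finrank ℚ K₀ = 2 → c K₀ = 0 := by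
    intro K₀ hK₀ hd
    have := hS K₀ hK₀
    have hterm : ∀ K ∈ S, c K * (Module.finrank ℚ (K ⊔ K₀ : IntermediateField ℚ L) : ℝ)⁻¹ =
        1 / 2 * (c K * (Module.finrank ℚ K : ℝ)⁻¹) + if K = K₀ then c K / 4 else 0 := by
      intro K hK
      have hpos : 0 < Module.finrank ℚ K := Module.finrank_pos
      have hle := hdeg K hK
      split_ifs with heq
      · subst heq
        rw [sup_idem, hd]; push_cast; ring
      · obtain h1 | h1 : Module.finrank ℚ K = 1 ∨ Module.finrank ℚ K = 2 := by omega
        · have : K = ⊥ := finrank_eq_one_iff.mp h1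
          rw [h1, this, bot_sup_eq, hd]; push_cast; ring
        · have h4 : Module.finrank ℚ (K ⊔ K₀ : IntermediateField ℚ L) = 4 := by
            have hub : Module.finrank ℚ (K ⊔ K₀ : IntermediateField ℚ L) ≤ 4 := by
              have := IntermediateField.finrank_sup_le K K₀
              rwa [h1, hd] at this
            have hdvd : 2 ∣ Module.finrank ℚ (K ⊔ K₀ : IntermediateField ℚ L) := by
              rw [← hd]
              exact finrank_dvd_of_le_right (le_sup_right : K₀ ≤ K ⊔ K₀)
            have hne : Module.finrank ℚ (K ⊔ K₀ : IntermediateField ℚ L) ≠ 2 := by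
              intro h3
              have e1 := eq_of_le_of_finrank_eq (le_sup_right : K₀ ≤ K ⊔ K₀) (hd.trans h3.symm)
              have e2 := eq_of_le_of_finrank_eq (le_sup_left : K ≤ K ⊔ K₀) (h1.trans h3.symm)
              exact heq (e2.trans e1.symm)
            have hpos' : 0 < Module.finrank ℚ (K ⊔ K₀ : IntermediateField ℚ L) := Module.finrank_pos
            omega
          rw [h4, h1]; push_cast; ring
    have hr := hrow K₀
    rw [Finset.sum_congr rfl hterm, Finset.sum_add_distrib, ← Finset.mul_sum, hT, mul_zero,
      zero_add, Finset.sum_ite_eq' S K₀, if_pos hK₀] at hr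
    linarith
  intro K hK
  have hpos : 0 < Module.finrank ℚ K := Module.finrank_pos
  obtain h1 | h1 : Module.finrank ℚ K = 1 ∨ Module.finrank ℚ K = 2 := by have := hdeg K hK; omega
  · have hbot : K = ⊥ := finrank_eq_one_iff.mp h1
    rw [Finset.sum_eq_single_of_mem K hK, h1, Nat.cast_one, inv_one, mul_one] at hT
    · exact hT
    · intro K' hK' hne
      have hpos' : 0 < Module.finrank ℚ K' := Module.finrank_pos
      have hne1 : Module.finrank ℚ K' ≠ 1 := fun h3 =>
        hne ((finrank_eq_one_iff.mp h3).trans hbot.symm)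
      rw [h2 K' hK' (by have := hdeg K' hK'; omega), zero_mul]
  · exact h2 K hK h1

open Classical in
/-- In the Galois group, the linear combination of the indicator functions of the fixing subgroups
vanishes: the sum of the squares of its values is a multiple of its inner product with itself. -/
lemma sum_fixing_eq_zero [IsGalois ℚ L] {c : IntermediateField ℚ L → ℝ}
    {S : Finset (IntermediateField ℚ L)} (hS : ∀ K ∈ S, Normal ℚ K) {B : ℕ}
    (h : ∀ p : Nat.Primes, B ≤ p → ∑ K ∈ S, c K * padicIndicator K p = 0)
    (σ : Gal(L/ℚ)) :
    ∑ K ∈ S, (if σ ∈ K.fixingSubgroup then c K else 0) = 0 := by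
  have hcard : ∀ K : IntermediateField ℚ L,
      ((Finset.univ.filter fun σ : Gal(L/ℚ) => σ ∈ K.fixingSubgroup).card : ℝ) =
        Module.finrank ℚ L * (Module.finrank ℚ K : ℝ)⁻¹ := by
    intro K
    have h1 := IsGalois.card_fixingSubgroup_eq_finrank K
    have h2 := Module.finrank_mul_finrank ℚ K L
    have h3 : (Module.finrank ℚ K : ℝ) ≠ 0 := by
      exact_mod_cast (Module.finrank_pos (R := ℚ) (M := K)).ne'
    rw [← h2]
    push_cast
    rw [mul_comm, ← mul_assoc, inv_mul_cancel₀ h3, one_mul, ← h1, Nat.card_eq_fintype_card,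
      Fintype.card_subtype]
  have hsq : ∑ σ : Gal(L/ℚ), (∑ K ∈ S, (if σ ∈ K.fixingSubgroup then c K else 0)) ^ 2 = 0 := by
    have hexp : ∀ σ : Gal(L/ℚ), (∑ K ∈ S, (if σ ∈ K.fixingSubgroup then c K else 0)) ^ 2 =
        ∑ K' ∈ S, ∑ K ∈ S, c K' * c K * (if σ ∈ (K ⊔ K').fixingSubgroup then 1 else 0) := by
      intro σ
      rw [sq, Finset.sum_mul_sum]
      refine Finset.sum_congr rfl fun K' _ => Finset.sum_congr rfl fun K _ => ?_
      rw [IntermediateField.fixingSubgroup_sup, Subgroup.mem_inf]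
      split_ifs <;> simp_all
    simp_rw [hexp]
    rw [Finset.sum_comm]
    refine Finset.sum_eq_zero fun K' hK' => ?_
    rw [Finset.sum_comm]
    have := hS K' hK'
    have hrow := sum_div_finrank_sup_eq_zero hS h K'
    calc _ = ∑ K ∈ S, c K' * c K * (Module.finrank ℚ L *
          (Module.finrank ℚ (K ⊔ K' : IntermediateField ℚ L) : ℝ)⁻¹) := by
          refine Finset.sum_congr rfl fun K _ => ?_
          rw [← Finset.mul_sum, ← hcard, Finset.sum_boole]
      _ = c K' * Module.finrank ℚ L * ∑ K ∈ S, c K *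
          (Module.finrank ℚ (K ⊔ K' : IntermediateField ℚ L) : ℝ)⁻¹ := by
          rw [Finset.mul_sum]
          exact Finset.sum_congr rfl fun K _ => by ring
      _ = 0 := by rw [hrow, mul_zero]
  have := (Finset.sum_eq_zero_iff_of_nonneg fun σ _ => sq_nonneg _).mp hsq σ (Finset.mem_univ σ)
  exact pow_eq_zero_iff two_ne_zero |>.mp this

/-- Linear independence for the subfields of a cyclic extension: a generator of the subgroup
fixing `K₀` fixes exactly the subfields of `K₀`. -/
lemma eq_zero_of_isCyclic [IsGalois ℚ L] [IsCyclic Gal(L/ℚ)] {c : IntermediateField ℚ L → ℝ}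
    {S : Finset (IntermediateField ℚ L)} (hS : ∀ K ∈ S, Normal ℚ K) {B : ℕ}
    (h : ∀ p : Nat.Primes, B ≤ p → ∑ K ∈ S, c K * padicIndicator K p = 0) :
    ∀ K ∈ S, c K = 0 := by
  classical
  have : Finite (IntermediateField ℚ L) :=
    Field.finite_intermediateField_of_exists_primitive_element ℚ L
      (Field.exists_primitive_element ℚ L)
  intro K₀
  induction K₀ using WellFoundedLT.induction with
  | ind K₀ ih =>
    intro hK₀
    obtain ⟨σ, hσ⟩ := IsCyclic.exists_generator (α := K₀.fixingSubgroup)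
    have hfix : ∀ K : IntermediateField ℚ L, (σ : Gal(L/ℚ)) ∈ K.fixingSubgroup ↔ K ≤ K₀ := by
      intro K
      have hz : Subgroup.zpowers (σ : Gal(L/ℚ)) = K₀.fixingSubgroup := by
        refine le_antisymm ((Subgroup.zpowers_le).mpr σ.2) fun τ hτ => ?_
        obtain ⟨k, hk⟩ := Subgroup.mem_zpowers_iff.mp (hσ ⟨τ, hτ⟩)
        exact Subgroup.mem_zpowers_iff.mpr ⟨k, congrArg Subtype.val hk⟩
      rw [← Subgroup.zpowers_le, hz, ← IntermediateField.le_iff_le,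
        IsGalois.fixedField_fixingSubgroup]
    have h0 := sum_fixing_eq_zero hS h (σ : Gal(L/ℚ))
    rw [Finset.sum_eq_single_of_mem K₀ hK₀] at h0
    · rwa [if_pos σ.2] at h0
    · intro K hK hne
      split_ifs with hmem
      · exact ih K (lt_of_le_of_ne ((hfix K).mp hmem) hne) hK
      · rfl

end Independence

/-! ### Factorizations over the integers and numbers of roots modulo primes -/

section Separation
open Filter

/-- The product of the integer polynomials `Fs`, each of them constant or irreducible over `ℚ`, is
`D` times `f`. The factors need not be primitive, and constants may occur among them. -/
structure IsIntFactorization (f : ℚ[X]) (D : ℤ) (Fs : List ℤ[X]) : Prop where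
  ne_zero : D ≠ 0
  C_mul_eq : C (D : ℚ) * f = (Fs.map (Polynomial.map (Int.castRingHom ℚ))).prod
  factors : ∀ F ∈ Fs, F ≠ 0 ∧ (F.natDegree = 0 ∨ Irreducible (F.map (Int.castRingHom ℚ)))

lemma exists_isIntFactorization {f : ℚ[X]} (hf : f ≠ 0) :
    ∃ (D : ℤ) (Fs : List ℤ[X]), IsIntFactorization f D Fs := by
  induction f using WfDvdMonoid.induction_on_irreducible with
  | zero => exact absurd rfl hf
  | unit u hu =>
    obtain ⟨n, Q, hn, hQ⟩ := exists_int_multiple u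
    have hdeg : (Q.map (Int.castRingHom ℚ)).natDegree = 0 := by
      rw [hQ, natDegree_C_mul (Int.cast_ne_zero.mpr hn)]
      exact natDegree_eq_zero_of_isUnit hu
    rw [natDegree_map_eq_of_injective Int.cast_injective] at hdeg
    refine ⟨n, [Q], hn, by simp [hQ], fun F hF => ?_⟩
    rw [List.mem_singleton.mp hF]
    refine ⟨?_, Or.inl hdeg⟩
    rintro rfl
    rw [Polynomial.map_zero] at hQ
    exact mul_ne_zero (C_ne_zero.mpr (Int.cast_ne_zero.mpr hn)) hf hQ.symm
  | mul a i ha hi ih =>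
    obtain ⟨D, Fs, hD, hFs, h⟩ := ih ha
    obtain ⟨n, Q, hn, hQ⟩ := exists_int_multiple i
    have hirr : Irreducible (Q.map (Int.castRingHom ℚ)) := by
      rw [hQ]
      have hu : IsUnit (C (n : ℚ)) := isUnit_C.mpr (Int.cast_ne_zero.mpr hn).isUnit
      exact (associated_unit_mul_left i _ hu).symm.irreducible hi
    refine ⟨n * D, Q :: Fs, mul_ne_zero hn hD, ?_, fun F hF => ?_⟩
    · rw [List.map_cons, List.prod_cons, ← hFs, hQ, Int.cast_mul, C_mul]
      ring
    · rcases List.mem_cons.mp hF with rfl | hF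
      · exact ⟨by rintro rfl; simp at hirr, Or.inr hirr⟩
      · exact h F hF

lemma eventually_modRoots_eq_empty {F : ℤ[X]} (hF : F ≠ 0) (hdeg : F.natDegree = 0) :
    ∀ᶠ p : ℕ in atTop, modRoots F p = ∅ := by
  obtain ⟨a, rfl⟩ := natDegree_eq_zero.mp hdeg
  have ha : a ≠ 0 := by rintro rfl; simp at hF
  filter_upwards [eventually_not_dvd ha] with p hp
  rw [Set.eq_empty_iff_forall_notMem]
  intro x hx
  rw [modRoots, Set.mem_ofPred_eq, map_C, eval_C, eq_intCast,
    ZMod.intCast_zmod_eq_zero_iff_dvd] at hx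
  exact hp hx

lemma adjoin_gen_eq_top {k L : Type*} [Field k] [Field L] [Algebra k L] (β : L) :
    k⟮AdjoinSimple.gen k β⟯ = ⊤ := by
  have h := IntermediateField.lift_adjoin_simple k k⟮β⟯ (AdjoinSimple.gen k β)
  rw [AdjoinSimple.coe_gen] at h
  exact IntermediateField.lift_injective _
    (h.trans (IntermediateField.lift_top (F := k) (E := L) k⟮β⟯).symm)

lemma exists_generator_adjoin {L : Type*} [Field L] [CharZero L] (β : L) (i : Algebra ℚ ℚ⟮β⟯) :
    ∃ α : ℚ⟮β⟯, (α : L) = β ∧ ℚ⟮α⟯ = ⊤ := by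
  obtain rfl : i = ℚ⟮β⟯.algebra' := Subsingleton.elim _ _
  exact ⟨_, AdjoinSimple.coe_gen ℚ β, adjoin_gen_eq_top β⟩

/-- For an irreducible or constant integer polynomial with Galois root fields, the number of roots
modulo a large prime is the number of roots, in a splitting field, that generate fields with an
embedding into `ℚ_p`. -/
lemma eventually_sum_padicIndicator_aroots {L : Type*} [Field L] [CharZero L]
    {F : ℤ[X]} (hF : F ≠ 0) (hirr : F.natDegree = 0 ∨ Irreducible (F.map (Int.castRingHom ℚ)))
    (hsplit : (F.map (algebraMap ℤ L)).Splits) (hnormal : ∀ β ∈ F.aroots L, Normal ℚ ℚ⟮β⟯) :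
    ∀ᶠ p : ℕ in atTop, ∀ hp : p.Prime,
      ((F.aroots L).map fun β => padicIndicator ℚ⟮β⟯ ⟨p, hp⟩).sum = ((modRoots F p).ncard : ℝ) := by
  have hcard : F.natDegree = (F.aroots L).card := by
    rw [← natDegree_map_eq_of_injective (FaithfulSMul.algebraMap_injective ℤ L),
      hsplit.natDegree_eq_card_roots]
  rcases hirr with hdeg | hirr
  · filter_upwards [eventually_modRoots_eq_empty hF hdeg] with p hp _
    rw [hp, Set.ncard_empty, Multiset.card_eq_zero.mp (hcard.symm.trans hdeg)]
    simp
  · have key : ∀ᶠ p : ℕ in atTop, ∀ β ∈ {β | β ∈ F.aroots L}, ∀ hp : p.Prime,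
        padicIndicator ℚ⟮β⟯ ⟨p, hp⟩ * F.natDegree = ((modRoots F p).ncard : ℝ) := by
      rw [eventually_all_finite (Multiset.finite_toSet _)]
      intro β hβ
      have := hnormal β hβ
      obtain ⟨α, hα, htop⟩ := exists_generator_adjoin β inferInstance
      have hroot : aeval α F = 0 := by
        apply (algebraMap ℚ⟮β⟯ L).injective
        rw [← aeval_algebraMap_apply, map_zero]
        change aeval (α : L) F = 0
        rw [hα]
        exact (mem_aroots.mp hβ).2
      filter_upwards [eventually_ncard_modRoots hirr hroot htop] with p hp hprime
      obtain ⟨h1, h2⟩ := hp ⟨hprime⟩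
      unfold padicIndicator
      split_ifs with h
      · rw [h1 h, one_mul]
      · rw [h2 h, zero_mul, Set.ncard_empty, Nat.cast_zero]
    filter_upwards [key] with p hp hprime
    have hpos : (F.natDegree : ℝ) ≠ 0 := by
      rw [Nat.cast_ne_zero, ← natDegree_map_eq_of_injective
        (f := Int.castRingHom ℚ) Int.cast_injective]
      exact hirr.natDegree_pos.ne'
    rw [Multiset.map_congr rfl (g := fun _ => ((modRoots F p).ncard : ℝ) / F.natDegree)
      fun β hβ => by rw [eq_div_iff hpos, hp β hβ hprime]]
    rw [Multiset.map_const', Multiset.sum_replicate, ← hcard, nsmul_eq_mul, mul_div_cancel₀ _ hpos]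

/-- The number of roots modulo a large prime, summed over the factors of an integer polynomial. -/
lemma eventually_sum_padicIndicator_list {L : Type*} [Field L] [CharZero L]
    (Fs : List ℤ[X])
    (hFs : ∀ F ∈ Fs, F ≠ 0 ∧ (F.natDegree = 0 ∨ Irreducible (F.map (Int.castRingHom ℚ))))
    (hsplit : (Fs.prod.map (algebraMap ℤ L)).Splits)
    (hnormal : ∀ β ∈ Fs.prod.aroots L, Normal ℚ ℚ⟮β⟯) :
    ∀ᶠ p : ℕ in atTop, ∀ hp : p.Prime,
      ((Fs.prod.aroots L).map fun β => padicIndicator ℚ⟮β⟯ ⟨p, hp⟩).sum =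
        (((Fs.map fun F => (modRoots F p).ncard).sum : ℕ) : ℝ) := by
  induction Fs with
  | nil => simp
  | cons F Fs ih =>
    have h0 : (0 : ℤ[X]) ∉ F :: Fs := fun h => (hFs 0 h).1 rfl
    have hprod : (F * Fs.prod).aroots L = F.aroots L + Fs.prod.aroots L := by
      refine aroots_mul ?_
      rw [← List.prod_cons]
      exact List.prod_ne_zero h0
    rw [List.prod_cons] at hsplit hnormal ⊢
    rw [hprod] at hnormal ⊢
    have hne : (F * Fs.prod).map (algebraMap ℤ L) ≠ 0 := by
      rw [Polynomial.map_ne_zero_iff (FaithfulSMul.algebraMap_injective ℤ L), ← List.prod_cons]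
      exact List.prod_ne_zero h0
    have h1 := eventually_sum_padicIndicator_aroots (hFs F List.mem_cons_self).1
      (hFs F List.mem_cons_self).2
      (hsplit.of_dvd hne (Polynomial.map_dvd _ (dvd_mul_right _ _)))
      fun β hβ => hnormal β (Multiset.mem_add.mpr (Or.inl hβ))
    have h2 := ih (fun G hG => hFs G (List.mem_cons_of_mem _ hG))
      (hsplit.of_dvd hne (Polynomial.map_dvd _ (dvd_mul_left _ _)))
      fun β hβ => hnormal β (Multiset.mem_add.mpr (Or.inr hβ))
    filter_upwards [h1, h2] with p h1 h2 hp
    rw [Multiset.map_add, Multiset.sum_add, h1 hp, h2 hp]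
    simp

end Separation
/-! ### Primes separating two polynomials -/

section SameRootFields
open Filter NumberField

/-- The fields generated by the roots of `f` in `L`, listed with multiplicity. -/
noncomputable def rootFields (L : Type*) [Field L] [CharZero L] (f : ℚ[X]) :
    Multiset (IntermediateField ℚ L) :=
  (f.aroots L).map fun β => ℚ⟮β⟯

lemma sameRootFields_of_rootFields_eq {L : Type*} [Field L] [NumberField L] {f g : ℚ[X]}
    (hf : (f.map (algebraMap ℚ L)).Splits) (hg : (g.map (algebraMap ℚ L)).Splits)
    (h : rootFields L f = rootFields L g) : SameRootFields f g := by
  let ι : L →ₐ[ℚ] ℂ := IsAlgClosed.lift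
  have hroots : ∀ q : ℚ[X], (q.map (algebraMap ℚ L)).Splits →
      q.aroots ℂ = (q.aroots L).map ι := by
    intro q hq
    have := hq.roots_map ι.toRingHom
    rw [Polynomial.map_map, AlgHom.toRingHom_eq_coe, AlgHom.comp_algebraMap] at this
    exact this
  rw [rootFields, rootFields, ← Multiset.rel_eq, Multiset.rel_map] at h
  rw [SameRootFields, hroots f hf, hroots g hg, Multiset.rel_map]
  refine h.mono fun α _ β _ hαβ => ?_
  have := congrArg (IntermediateField.map ι) hαβ
  rwa [adjoin_map, adjoin_map, Set.image_singleton, Set.image_singleton] at this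

lemma aroots_of_C_mul_eq {L : Type*} [Field L] [CharZero L] {f : ℚ[X]} {D : ℤ} (hD : D ≠ 0)
    {F : ℤ[X]} (h : C (D : ℚ) * f = F.map (Int.castRingHom ℚ)) :
    F.aroots L = f.aroots L := by
  rw [← aroots_C_mul f (Int.cast_ne_zero.mpr hD), h, ← algebraMap_int_eq, aroots_map]

lemma splits_of_C_mul_eq {L : Type*} [Field L] [CharZero L] {f : ℚ[X]} {D : ℤ}
    {F : ℤ[X]} (h : C (D : ℚ) * f = F.map (Int.castRingHom ℚ))
    (hf : (f.map (algebraMap ℚ L)).Splits) : (F.map (algebraMap ℤ L)).Splits := by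
  have h2 : F.map (algebraMap ℤ L) = C (D : L) * f.map (algebraMap ℚ L) := by
    rw [IsScalarTower.algebraMap_eq ℤ ℚ L, ← Polynomial.map_map, algebraMap_int_eq, ← h,
      Polynomial.map_mul, map_C, map_intCast]
  rw [h2]
  exact hf.C_mul _

/-- If the fields generated by the roots of `f` and `g` are different, and their indicator functions
are linearly independent, then there are arbitrarily large primes modulo which the factors of `f`
and those of `g` have different numbers of roots. -/
theorem exists_prime_sum_ncard_ne {L : Type*} [Field L] [NumberField L] {f g : ℚ[X]}
    (hf : (f.map (algebraMap ℚ L)).Splits) (hg : (g.map (algebraMap ℚ L)).Splits)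
    (hsame : ¬ SameRootFields f g)
    (hnormal : ∀ K ∈ rootFields L f + rootFields L g, Normal ℚ K)
    (hindep : ∀ (c : IntermediateField ℚ L → ℝ) (S : Finset (IntermediateField ℚ L)),
      (∀ K ∈ S, K ∈ rootFields L f + rootFields L g) → ∀ B : ℕ,
      (∀ p : Nat.Primes, B ≤ p → ∑ K ∈ S, c K * padicIndicator K p = 0) → ∀ K ∈ S, c K = 0)
    {D E : ℤ} {Fs Gs : List ℤ[X]} (hFs : IsIntFactorization f D Fs)
    (hGs : IsIntFactorization g E Gs) (B : ℕ) :
    ∃ p ≥ B, p.Prime ∧ (Fs.map fun F => (modRoots F p).ncard).sum ≠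
      (Gs.map fun G => (modRoots G p).ncard).sum := by
  classical
  by_contra! hcon
  apply hsame
  apply sameRootFields_of_rootFields_eq hf hg
  have hmap : ∀ l : List ℤ[X], (l.map (Polynomial.map (Int.castRingHom ℚ))).prod =
      l.prod.map (Int.castRingHom ℚ) := fun l => by
    rw [← coe_mapRingHom, map_list_prod]
  have hDf := hFs.C_mul_eq
  have hEg := hGs.C_mul_eq
  rw [hmap] at hDf hEg
  have haf : Fs.prod.aroots L = f.aroots L := aroots_of_C_mul_eq hFs.ne_zero hDf
  have hag : Gs.prod.aroots L = g.aroots L := aroots_of_C_mul_eq hGs.ne_zero hEg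
  have hf' := eventually_sum_padicIndicator_list Fs hFs.factors (splits_of_C_mul_eq hDf hf)
    fun β hβ => hnormal _ (Multiset.mem_add.mpr (Or.inl (Multiset.mem_map_of_mem _ (haf ▸ hβ))))
  have hg' := eventually_sum_padicIndicator_list Gs hGs.factors (splits_of_C_mul_eq hEg hg)
    fun β hβ => hnormal _ (Multiset.mem_add.mpr (Or.inr (Multiset.mem_map_of_mem _ (hag ▸ hβ))))
  obtain ⟨B', hB'⟩ := eventually_atTop.mp (hf'.and hg')
  have hrf : ∀ (q : ℚ[X]) (p : Nat.Primes),
      ((rootFields L q).map fun K : IntermediateField ℚ L => padicIndicator K p).sum =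
      ((q.aroots L).map fun β => padicIndicator ℚ⟮β⟯ p).sum := fun q p => by
    rw [rootFields, Multiset.map_map]; rfl
  -- equal numbers of roots mean that the differences of the multiplicities are the coefficients of
  -- a linear combination of indicators that vanishes at large primes
  have hzero := hindep (fun K => ((rootFields L f).count K : ℝ) - (rootFields L g).count K)
    (rootFields L f + rootFields L g).toFinset (fun K hK => Multiset.mem_toFinset.mp hK)
    (max B B') fun p hp => by
      have h1 := (hB' p ((le_max_right _ _).trans hp)).1 p.2
      have h2 := (hB' p ((le_max_right _ _).trans hp)).2 p.2
      have h3 := hcon p ((le_max_left _ _).trans hp) p.2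
      rw [haf] at h1
      rw [hag, ← h3, ← h1] at h2
      have hsum : ∀ M : Multiset (IntermediateField ℚ L),
          M ≤ rootFields L f + rootFields L g →
          (M.map fun K : IntermediateField ℚ L => padicIndicator K p).sum =
            ∑ K ∈ (rootFields L f + rootFields L g).toFinset,
              (M.count K : ℝ) * padicIndicator K p := by
        intro M hM
        rw [Finset.sum_multiset_map_count]
        simp only [nsmul_eq_mul]
        refine Finset.sum_subset (Multiset.toFinset_subset.mpr (Multiset.subset_of_le hM)) ?_
        intro K _ hK
        rw [Multiset.count_eq_zero.mpr fun h => hK (Multiset.mem_toFinset.mpr h), Nat.cast_zero,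
          zero_mul]
      simp only [sub_mul, Finset.sum_sub_distrib]
      rw [← hsum _ (Multiset.le_add_right _ _), ← hsum _ (Multiset.le_add_left _ _), hrf, hrf,
        sub_eq_zero]
      exact h2.symm
  ext K
  by_cases hK : K ∈ rootFields L f + rootFields L g
  · have := hzero K (Multiset.mem_toFinset.mpr hK)
    exact_mod_cast sub_eq_zero.mp this
  · rw [Multiset.mem_add, not_or] at hK
    rw [Multiset.count_eq_zero.mpr hK.1, Multiset.count_eq_zero.mpr hK.2]

lemma mem_rootFields_add {L : Type*} [Field L] [CharZero L] {f g : ℚ[X]} (h : f * g ≠ 0)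
    {K : IntermediateField ℚ L} (hK : K ∈ rootFields L f + rootFields L g) :
    ∃ β : L, aeval β (f * g) = 0 ∧ K = ℚ⟮β⟯ := by
  have hK' : K ∈ (((f * g).aroots L).map fun β => ℚ⟮β⟯) := by
    rwa [aroots_mul h, Multiset.map_add]
  obtain ⟨β, hβ, rfl⟩ := Multiset.mem_map.mp hK'
  exact ⟨β, (mem_aroots.mp hβ).2, rfl⟩

lemma finrank_adjoin_le_two {k L : Type*} [Field k] [Field L] [Algebra k L] {P : k[X]} (hP : P ≠ 0)
    (h : ∀ q : k[X], Irreducible q → q ∣ P → q.natDegree ≤ 2) {β : L} (hβ : aeval β P = 0) :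
    Module.finrank k k⟮β⟯ ≤ 2 ∧ Normal k k⟮β⟯ := by
  have hint : IsIntegral k β := (show IsAlgebraic k β from ⟨P, hP, hβ⟩).isIntegral
  have hle := h _ (minpoly.irreducible hint) (minpoly.dvd k β hβ)
  rw [← adjoin.finrank hint] at hle
  refine ⟨hle, ?_⟩
  have := adjoin.finiteDimensional hint
  have hpos : 0 < Module.finrank k k⟮β⟯ := Module.finrank_pos
  rcases (by omega : Module.finrank k k⟮β⟯ = 1 ∨ Module.finrank k k⟮β⟯ = 2) with h1 | h1
  · have hbot := IntermediateField.finrank_eq_one_iff.mp h1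
    rw [hbot]
    infer_instance
  · have : Algebra.IsQuadraticExtension k k⟮β⟯ := ⟨h1⟩
    infer_instance

lemma normal_intermediateField_of_isCyclic {k L : Type*} [Field k] [Field L] [Algebra k L]
    [FiniteDimensional k L] [IsGalois k L] [IsCyclic Gal(L/k)] (K : IntermediateField k L) :
    Normal k K := by
  let _ : CommGroup Gal(L/k) := IsCyclic.commGroup
  have hn : K.fixingSubgroup.Normal := ⟨fun a ha b => by
    rwa [show b * a * b⁻¹ = a by rw [mul_comm b a, mul_inv_cancel_right]]⟩
  have := IsGalois.of_fixedField_normal_subgroup K.fixingSubgroup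
  rw [IsGalois.fixedField_fixingSubgroup] at this
  infer_instance

theorem exists_prime_sum_ncard_ne_of_splits {L : Type*} [Field L] [i : NumberField L]
    {f g : ℚ[X]} (hfg : f * g ≠ 0) (hsplit : ((f * g).map (algebraMap ℚ L)).Splits)
    (hsame : ¬ SameRootFields f g)
    (hcond : FactorsDegreeLeTwo (f * g) ∨ IsGalois ℚ L ∧ IsCyclic Gal(L/ℚ))
    {D E : ℤ} {Fs Gs : List ℤ[X]} (hFs : IsIntFactorization f D Fs)
    (hGs : IsIntFactorization g E Gs) (B : ℕ) :
    ∃ p ≥ B, p.Prime ∧ (Fs.map fun F => (modRoots F p).ncard).sum ≠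
      (Gs.map fun G => (modRoots G p).ncard).sum := by
  have hne : (f * g).map (algebraMap ℚ L) ≠ 0 :=
    (Polynomial.map_ne_zero_iff (algebraMap ℚ L).injective).mpr hfg
  have hf := hsplit.of_dvd hne (Polynomial.map_dvd _ (dvd_mul_right _ _))
  have hg := hsplit.of_dvd hne (Polynomial.map_dvd _ (dvd_mul_left _ _))
  rcases hcond with h | ⟨h1, h2⟩
  · have key : ∀ K ∈ rootFields L f + rootFields L g, Module.finrank ℚ K ≤ 2 ∧ Normal ℚ K := by
      intro K hK
      obtain ⟨β, hβ, rfl⟩ := mem_rootFields_add hfg hK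
      obtain ⟨h3, h4⟩ := finrank_adjoin_le_two hfg h hβ
      refine ⟨?_, normal_of_normal_algebra h4⟩
      convert h3
    refine exists_prime_sum_ncard_ne hf hg hsame (fun K hK => (key K hK).2) ?_ hFs hGs B
    intro c S hS B hB
    exact eq_zero_of_finrank_le_two (fun K hK => (key K (hS K hK)).1)
      (fun K hK => (key K (hS K hK)).2) hB
  · have key : ∀ K : IntermediateField ℚ L, Normal ℚ K := fun K =>
      normal_of_normal_algebra (normal_intermediateField_of_isCyclic K)
    refine exists_prime_sum_ncard_ne hf hg hsame (fun K _ => key K) ?_ hFs hGs B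
    intro c S _ B hB
    exact eq_zero_of_isCyclic (fun K _ => key K) hB

lemma exists_prime_sum_ncard_ne_of_algebra {L : Type*} [Field L] [CharZero L] (i : Algebra ℚ L)
    (hfin : FiniteDimensional ℚ L) {f g : ℚ[X]} (hfg : f * g ≠ 0)
    (hsplit : ((f * g).map (algebraMap ℚ L)).Splits) (hsame : ¬ SameRootFields f g)
    (hcond : FactorsDegreeLeTwo (f * g) ∨ IsGalois ℚ L ∧ IsCyclic Gal(L/ℚ))
    {D E : ℤ} {Fs Gs : List ℤ[X]} (hFs : IsIntFactorization f D Fs)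
    (hGs : IsIntFactorization g E Gs) (B : ℕ) :
    ∃ p ≥ B, p.Prime ∧ (Fs.map fun F => (modRoots F p).ncard).sum ≠
      (Gs.map fun G => (modRoots G p).ncard).sum := by
  obtain rfl : i = DivisionRing.toRatAlgebra := Subsingleton.elim _ _
  have : NumberField L := ⟨⟩
  exact exists_prime_sum_ncard_ne_of_splits hfg hsplit hsame hcond hFs hGs B

/-- For the sequences of the theorem there are arbitrarily large primes modulo which the factors of
`f` and those of `g` have different numbers of roots. -/
theorem exists_prime_sum_ncard_ne_of_cond {f g : ℚ[X]} (hfg : f * g ≠ 0)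
    (hsame : ¬ SameRootFields f g)
    (hcond : FactorsDegreeLeTwo (f * g) ∨ CyclicSplittingField (f * g))
    {D E : ℤ} {Fs Gs : List ℤ[X]} (hFs : IsIntFactorization f D Fs)
    (hGs : IsIntFactorization g E Gs) (B : ℕ) :
    ∃ p ≥ B, p.Prime ∧ (Fs.map fun F => (modRoots F p).ncard).sum ≠
      (Gs.map fun G => (modRoots G p).ncard).sum := by
  have hchar : CharZero (f * g).SplittingField := charZero_of_injective_algebraMap
    (algebraMap ℚ (f * g).SplittingField).injective
  exact exists_prime_sum_ncard_ne_of_algebra (L := (f * g).SplittingField) _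
    (inferInstanceAs (FiniteDimensional ℚ (f * g).SplittingField)) hfg
    (SplittingField.splits (f * g)) hsame hcond hFs hGs B

end SameRootFields

/-! ### Exponents of `p` in products of consecutive values -/

section Counting
open Finset

/-- In a run of `n` consecutive integers a residue class modulo `M` has `⌊n/M⌋` or `⌊n/M⌋ + 1`
members. -/
lemma card_filter_cast_eq {M : ℕ} [NeZero M] (ρ : ZMod M) (n : ℕ) :
    n / M ≤ #{k ∈ range n | ((k + 1 : ℕ) : ZMod M) = ρ} ∧
      #{k ∈ range n | ((k + 1 : ℕ) : ZMod M) = ρ} ≤ n / M + 1 := by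
  have h : ∀ k : ℕ, ((k + 1 : ℕ) : ZMod M) = ρ ↔ k ≡ (ρ - 1).val [MOD M] := by
    intro k
    rw [← ZMod.natCast_eq_natCast_iff, ZMod.natCast_zmod_val, Nat.cast_add, Nat.cast_one,
      eq_sub_iff_add_eq]
  simp only [h]
  rw [← Nat.count_eq_card_filter_range, Nat.count_modEq_card _ (NeZero.pos M)]
  split_ifs <;> omega

variable {p : ℕ} [Fact p.Prime]

/-- The powers of `p` dividing the values of `F` are governed by the `p`-adic root above a simple
root modulo `p`. -/
lemma exists_residue_of_simple_root {F : ℤ[X]} {x : ZMod p} (hx : x ∈ modRoots F p)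
    (hx' : ((derivative F).map (Int.castRingHom (ZMod p))).eval x ≠ 0) {j : ℕ} (hj : 1 ≤ j) :
    ∃ ρ : ZMod (p ^ j), ∀ k : ℕ,
      ((k : ZMod p) = x ∧ ((p : ℤ) ^ j ∣ F.eval (k : ℤ))) ↔ (k : ZMod (p ^ j)) = ρ := by
  obtain ⟨z, hz, hzx, -⟩ := hensel_lift hx hx'
  refine ⟨PadicInt.toZModPow j z, fun k => ?_⟩
  have hmem : (k : ZMod (p ^ j)) = PadicInt.toZModPow j z ↔
      ‖(k : ℤ_[p]) - z‖ ≤ (p : ℝ) ^ (-(j : ℤ)) := by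
    rw [PadicInt.norm_le_pow_iff_mem_span_pow, ← PadicInt.ker_toZModPow, RingHom.mem_ker, map_sub,
      map_natCast, sub_eq_zero]
  have hp1 : (1 : ℝ) < p := by exact_mod_cast (Fact.out : p.Prime).one_lt
  have hlt : (p : ℝ) ^ (-(j : ℤ)) < 1 := zpow_lt_one_of_neg₀ hp1 (by omega)
  -- `F k = (F' z + c * (k - z)) * (k - z)`, where the first factor is a unit
  have hnorm : (k : ZMod p) = x → ‖((F.eval (k : ℤ) : ℤ) : ℤ_[p])‖ = ‖(k : ℤ_[p]) - z‖ := by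
    intro hk
    have hF0 : (F.map (algebraMap ℤ ℤ_[p])).eval z = 0 := by rw [eval_map, ← aeval_def, hz]
    obtain ⟨c, hc⟩ := binomExpansion (F.map (algebraMap ℤ ℤ_[p])) z ((k : ℤ_[p]) - z)
    rw [add_sub_cancel, hF0, zero_add] at hc
    have heval : (F.map (algebraMap ℤ ℤ_[p])).eval (k : ℤ_[p]) =
        ((F.eval (k : ℤ) : ℤ) : ℤ_[p]) := by
      rw [eval_map, ← Int.cast_natCast (R := ℤ_[p]) k, ← eq_intCast (algebraMap ℤ ℤ_[p]) (k : ℤ),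
        eval₂_at_apply, eq_intCast]
    rw [heval, show ∀ a b : ℤ_[p], a * b + c * b ^ 2 = (a + c * b) * b by intros; ring] at hc
    rw [hc, norm_mul, (toZMod_ne_zero_iff _).mp, one_mul]
    rw [map_add, map_mul, map_sub, map_natCast, hk, hzx, sub_self, mul_zero, add_zero,
      derivative_map, eval_map, ← aeval_def, toZMod_aeval, hzx]
    exact hx'
  have hdvd : ((p : ℤ) ^ j ∣ F.eval (k : ℤ)) ↔
      ‖((F.eval (k : ℤ) : ℤ) : ℤ_[p])‖ ≤ (p : ℝ) ^ (-(j : ℤ)) :=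
    PadicInt.norm_int_le_pow_iff_dvd.symm
  rw [hmem, hdvd]
  constructor
  · rintro ⟨h1, h2⟩
    rwa [hnorm h1] at h2
  · intro h
    have hk : (k : ZMod p) = x := by
      rw [← hzx, ← map_natCast (PadicInt.toZMod (p := p)), toZMod_eq_iff]
      exact h.trans_lt hlt
    exact ⟨hk, by rwa [hnorm hk]⟩

/-- The number of multiples of `p ^ j` among the first `n` values of a polynomial with simple roots
modulo `p`. -/
lemma card_filter_pow_dvd_eval {F : ℤ[X]}
    (hsimple : ∀ x ∈ modRoots F p, ((derivative F).map (Int.castRingHom (ZMod p))).eval x ≠ 0)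
    (n : ℕ) {j : ℕ} (hj : 1 ≤ j) :
    (modRoots F p).ncard * (n / p ^ j) ≤ #{k ∈ range n | (p : ℤ) ^ j ∣ F.eval ((k + 1 : ℕ) : ℤ)} ∧
      #{k ∈ range n | (p : ℤ) ^ j ∣ F.eval ((k + 1 : ℕ) : ℤ)} ≤
        (modRoots F p).ncard * (n / p ^ j + 1) := by
  classical
  choose! ρ hρ using fun (x : ZMod p) (hx : x ∈ modRoots F p) =>
    exists_residue_of_simple_root hx (hsimple x hx) hj
  have hroot : ∀ k : ℕ, (p : ℤ) ^ j ∣ F.eval (k : ℤ) → (k : ZMod p) ∈ modRoots F p := by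
    intro k hk
    have h1 : (p : ℤ) ∣ F.eval (k : ℤ) := (dvd_pow_self _ (by omega)).trans hk
    rw [← ZMod.intCast_zmod_eq_zero_iff_dvd] at h1
    change eval _ _ = 0
    rw [← h1, eval_map, ← Int.cast_natCast (R := ZMod p) k,
      ← eq_intCast (Int.castRingHom (ZMod p)) (k : ℤ), eval₂_at_apply, eq_intCast]
  have hset : ({k ∈ range n | (p : ℤ) ^ j ∣ F.eval ((k + 1 : ℕ) : ℤ)} : Finset ℕ) =
      (Set.toFinite (modRoots F p)).toFinset.biUnion
        fun x => {k ∈ range n | ((k + 1 : ℕ) : ZMod (p ^ j)) = ρ x} := by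
    ext k
    simp only [mem_filter, mem_biUnion, Set.Finite.mem_toFinset]
    constructor
    · rintro ⟨hk, hd⟩
      exact ⟨_, hroot _ hd, hk, (hρ _ (hroot _ hd) _).mp ⟨rfl, hd⟩⟩
    · rintro ⟨x, hx, hk, h⟩
      exact ⟨hk, ((hρ x hx _).mpr h).2⟩
  have hcard : #{k ∈ range n | (p : ℤ) ^ j ∣ F.eval ((k + 1 : ℕ) : ℤ)} =
      ∑ x ∈ (Set.toFinite (modRoots F p)).toFinset,
        #{k ∈ range n | ((k + 1 : ℕ) : ZMod (p ^ j)) = ρ x} := by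
    rw [hset, card_biUnion]
    intro x hx y hy hxy
    rw [Set.Finite.coe_toFinset] at hx hy
    rw [Function.onFun, Finset.disjoint_left]
    intro k hkx hky
    rw [mem_filter] at hkx hky
    exact hxy (((hρ x hx _).mpr hkx.2).1.symm.trans ((hρ y hy _).mpr hky.2).1)
  have hp : NeZero (p ^ j) := ⟨pow_ne_zero _ (Fact.out : p.Prime).ne_zero⟩
  rw [hcard, Set.ncard_eq_toFinset_card _ (Set.toFinite (modRoots F p))]
  exact ⟨card_nsmul_le_sum _ _ _ fun x _ => (card_filter_cast_eq (ρ x) n).1,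
    sum_le_card_nsmul _ _ _ fun x _ => (card_filter_cast_eq (ρ x) n).2⟩

/-- The exponent of `p` in a product of consecutive values of a polynomial with simple roots modulo
`p`, when these values are less than `p ^ b`. -/
lemma factorization_prod_eval {F : ℤ[X]}
    (hsimple : ∀ x ∈ modRoots F p, ((derivative F).map (Int.castRingHom (ZMod p))).eval x ≠ 0)
    {n b : ℕ} (h0 : ∀ k < n, F.eval ((k + 1 : ℕ) : ℤ) ≠ 0)
    (hb : ∀ k < n, (F.eval ((k + 1 : ℕ) : ℤ)).natAbs < p ^ b) :
    (modRoots F p).ncard * ∑ j ∈ Ico 1 b, n / p ^ j ≤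
        (∏ k ∈ range n, (F.eval ((k + 1 : ℕ) : ℤ)).natAbs).factorization p ∧
      (∏ k ∈ range n, (F.eval ((k + 1 : ℕ) : ℤ)).natAbs).factorization p ≤
        (modRoots F p).ncard * (∑ j ∈ Ico 1 b, n / p ^ j + b) := by
  have hp : p.Prime := Fact.out
  have hsum : (∏ k ∈ range n, (F.eval ((k + 1 : ℕ) : ℤ)).natAbs).factorization p =
      ∑ j ∈ Ico 1 b, #{k ∈ range n | (p : ℤ) ^ j ∣ F.eval ((k + 1 : ℕ) : ℤ)} := by
    rw [Nat.factorization_prod fun k hk => Int.natAbs_ne_zero.mpr (h0 k (mem_range.mp hk)),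
      Finsupp.finsetSum_apply]
    rw [sum_congr rfl fun k hk => Nat.factorization_eq_card_pow_dvd_of_lt hp
      (Int.natAbs_pos.mpr (h0 k (mem_range.mp hk))) (hb k (mem_range.mp hk))]
    have := sum_card_bipartiteAbove_eq_sum_card_bipartiteBelow
      (fun (k : ℕ) (j : ℕ) => (p : ℤ) ^ j ∣ F.eval ((k + 1 : ℕ) : ℤ)) (s := range n) (t := Ico 1 b)
    refine Eq.trans ?_ this
    refine sum_congr rfl fun k _ => congrArg card (filter_congr fun j _ => ?_)
    rw [← Int.natCast_dvd_natCast, Int.dvd_natAbs, Nat.cast_pow]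
  rw [hsum]
  constructor
  · rw [mul_sum]
    exact sum_le_sum fun j hj => (card_filter_pow_dvd_eval hsimple n (mem_Ico.mp hj).1).1
  · calc _ ≤ ∑ j ∈ Ico 1 b, (modRoots F p).ncard * (n / p ^ j + 1) :=
          sum_le_sum fun j hj => (card_filter_pow_dvd_eval hsimple n (mem_Ico.mp hj).1).2
      _ = (modRoots F p).ncard * (∑ j ∈ Ico 1 b, n / p ^ j + (b - 1)) := by
          rw [← mul_sum, sum_add_distrib, sum_const, Nat.card_Ico, smul_eq_mul, mul_one]
      _ ≤ _ := Nat.mul_le_mul_left _ (by omega)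

end Counting

/-! ### Polynomials given by lists of integers -/

section Lists
open Finset

/-- The value at `x` of the polynomial with a given list of integer coefficients, constant
coefficient first. -/
def listEval (l : List ℤ) (x : ℕ) : ℤ := l.foldr (fun a b => a + x * b) 0

/-- The polynomial with a given list of integer coefficients, constant coefficient first. -/
noncomputable def listPoly (l : List ℤ) : ℤ[X] := l.foldr (fun a q => C a + X * q) 0

lemma eval_listPoly (l : List ℤ) (x : ℕ) : (listPoly l).eval (x : ℤ) = listEval l x := by
  induction l with
  | nil => simp [listPoly, listEval]
  | cons a l ih =>
    rw [listPoly, listEval, List.foldr_cons, List.foldr_cons, ← listPoly, ← listEval, eval_add,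
      eval_C, eval_mul, eval_X, ih]

lemma natAbs_listEval_le (l : List ℤ) {x : ℕ} (hx : 1 ≤ x) :
    (listEval l x).natAbs ≤ (l.map Int.natAbs).sum * x ^ l.length := by
  induction l with
  | nil => simp [listEval]
  | cons a l ih =>
    rw [listEval, List.foldr_cons, ← listEval, List.map_cons, List.sum_cons, List.length_cons]
    have h1 : 1 ≤ x ^ (l.length + 1) := Nat.one_le_pow _ _ hx
    calc (a + x * listEval l x).natAbs ≤ a.natAbs + x * (listEval l x).natAbs := by
          refine (Int.natAbs_add_le _ _).trans ?_
          rw [Int.natAbs_mul, Int.natAbs_natCast]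
      _ ≤ a.natAbs * x ^ (l.length + 1) + x * ((l.map Int.natAbs).sum * x ^ l.length) := by
          gcongr
          exact Nat.le_mul_of_pos_right _ h1
      _ = _ := by ring

/-- The number of roots modulo `p` of the polynomial with coefficients `l`. -/
def rootCount (p : ℕ) (l : List ℤ) : ℕ :=
  ((List.range p).filter fun x => (listEval l x).natAbs % p = 0).length

/-- The roots modulo `p` of the polynomial `F` with coefficients `l` are simple. This uses that
`F (x + p) - F x` is congruent to `p * F' x` modulo `p ^ 2`. -/
def HasSimpleRoots (p : ℕ) (l : List ℤ) : Prop :=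
  ∀ x < p, (listEval l x).natAbs % p = 0 →
    ¬ (listEval l (x + p) + -listEval l x).natAbs % (p * p) = 0

lemma natAbs_mod_eq_zero_iff {a : ℤ} {m : ℕ} : a.natAbs % m = 0 ↔ (m : ℤ) ∣ a := by
  rw [← Nat.dvd_iff_mod_eq_zero, Int.natCast_dvd]

lemma cast_mem_modRoots_iff {p : ℕ} (l : List ℤ) (x : ℕ) :
    (x : ZMod p) ∈ modRoots (listPoly l) p ↔ (listEval l x).natAbs % p = 0 := by
  rw [natAbs_mod_eq_zero_iff, ← ZMod.intCast_zmod_eq_zero_iff_dvd, ← eval_listPoly]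
  change eval _ _ = 0 ↔ _
  rw [eval_map, ← Int.cast_natCast (R := ZMod p) x,
    ← eq_intCast (Int.castRingHom (ZMod p)) (x : ℤ), eval₂_at_apply, eq_intCast]

variable {p : ℕ} [Fact p.Prime]

lemma rootCount_eq_ncard (l : List ℤ) : rootCount p l = (modRoots (listPoly l) p).ncard := by
  have hp := (Fact.out : p.Prime).pos
  have h1 : rootCount p l = #{x ∈ range p | (listEval l x).natAbs % p = 0} := by
    rw [rootCount, card_def, filter_val, range_val, Multiset.range, Multiset.filter_coe,
      Multiset.coe_card]
  rw [h1, ← Set.ncard_coe_finset]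
  refine (Set.InjOn.ncard_image (f := fun x : ℕ => (x : ZMod p)) ?_).symm.trans
    (congrArg Set.ncard ?_)
  · intro x hx y hy hxy
    rw [Finset.mem_coe, mem_filter, mem_range] at hx hy
    have := (ZMod.natCast_eq_natCast_iff _ _ _).mp hxy
    rwa [Nat.ModEq, Nat.mod_eq_of_lt hx.1, Nat.mod_eq_of_lt hy.1] at this
  · ext y
    constructor
    · rintro ⟨x, hx, rfl⟩
      rw [Finset.mem_coe, mem_filter] at hx
      exact (cast_mem_modRoots_iff l x).mpr hx.2
    · intro hy
      have hval : ((y.val : ℕ) : ZMod p) = y := ZMod.natCast_zmod_val y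
      refine ⟨y.val, ?_, hval⟩
      rw [Finset.mem_coe, mem_filter, mem_range]
      exact ⟨ZMod.val_lt y, (cast_mem_modRoots_iff l _).mp (by rwa [hval])⟩

lemma hasSimpleRoots_iff (l : List ℤ) :
    HasSimpleRoots p l ↔ ∀ x ∈ modRoots (listPoly l) p,
      ((derivative (listPoly l)).map (Int.castRingHom (ZMod p))).eval x ≠ 0 := by
  have hp : (p : ℤ) ≠ 0 := by exact_mod_cast (Fact.out : p.Prime).ne_zero
  have key : ∀ x : ℕ, (listEval l (x + p) + -listEval l x).natAbs % (p * p) = 0 ↔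
      ((derivative (listPoly l)).map (Int.castRingHom (ZMod p))).eval (x : ZMod p) = 0 := by
    intro x
    obtain ⟨c, hc⟩ := binomExpansion (listPoly l) (x : ℤ) (p : ℤ)
    have h1 : (listEval l (x + p) + -listEval l x) =
        p * ((derivative (listPoly l)).eval (x : ℤ) + c * p) := by
      rw [← eval_listPoly, ← eval_listPoly, Nat.cast_add, hc]
      ring
    rw [natAbs_mod_eq_zero_iff, h1, Nat.cast_mul, mul_dvd_mul_iff_left hp,
      dvd_add_left (dvd_mul_left _ _), ← ZMod.intCast_zmod_eq_zero_iff_dvd, eval_map,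
      ← Int.cast_natCast (R := ZMod p) x, ← eq_intCast (Int.castRingHom (ZMod p)) (x : ℤ),
      eval₂_at_apply, eq_intCast]
  constructor
  · intro h y hy
    have hval : ((y.val : ℕ) : ZMod p) = y := ZMod.natCast_zmod_val y
    rw [← hval] at hy ⊢
    rw [Ne, ← key]
    exact h _ (ZMod.val_lt y) ((cast_mem_modRoots_iff l _).mp hy)
  · intro h x _ hx
    rw [key]
    exact h _ ((cast_mem_modRoots_iff l x).mpr hx)

/-- The value at `x` of a product of polynomials given by their lists of coefficients. -/
def prodEval (Fs : List (List ℤ)) (x : ℕ) : ℤ := (Fs.map fun l => listEval l x).prod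

/-- The total number of roots modulo `p` of a list of polynomials. -/
def rootCountSum (p : ℕ) (Fs : List (List ℤ)) : ℕ := (Fs.map (rootCount p)).sum

lemma prodEval_cons (l : List ℤ) (Fs : List (List ℤ)) (x : ℕ) :
    prodEval (l :: Fs) x = listEval l x * prodEval Fs x := by
  rw [prodEval, List.map_cons, List.prod_cons, prodEval]

lemma factorization_prod_prodEval {Fs : List (List ℤ)} (hsimple : ∀ F ∈ Fs, HasSimpleRoots p F)
    {n b : ℕ} (h0 : ∀ k < n, prodEval Fs (k + 1) ≠ 0)
    (hb : ∀ F ∈ Fs, ∀ k < n, (listEval F (k + 1)).natAbs < p ^ b) :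
    rootCountSum p Fs * ∑ j ∈ Ico 1 b, n / p ^ j ≤
        (∏ k ∈ range n, (prodEval Fs (k + 1)).natAbs).factorization p ∧
      (∏ k ∈ range n, (prodEval Fs (k + 1)).natAbs).factorization p ≤
        rootCountSum p Fs * (∑ j ∈ Ico 1 b, n / p ^ j + b) := by
  induction Fs with
  | nil => simp [rootCountSum, prodEval]
  | cons F Fs ih =>
    simp only [prodEval_cons] at h0 ⊢
    have h1 : ∀ k < n, listEval F (k + 1) ≠ 0 := fun k hk => left_ne_zero_of_mul (h0 k hk)
    have h2 : ∀ k < n, prodEval Fs (k + 1) ≠ 0 := fun k hk => right_ne_zero_of_mul (h0 k hk)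
    obtain ⟨ih1, ih2⟩ := ih (fun G hG => hsimple G (List.mem_cons_of_mem _ hG)) h2
      fun G hG => hb G (List.mem_cons_of_mem _ hG)
    obtain ⟨hF1, hF2⟩ := factorization_prod_eval (n := n) (b := b)
      ((hasSimpleRoots_iff F).mp (hsimple F List.mem_cons_self))
      (fun k hk => by rw [eval_listPoly]; exact h1 k hk)
      fun k hk => by rw [eval_listPoly]; exact hb F List.mem_cons_self k hk
    simp only [eval_listPoly, ← rootCount_eq_ncard] at hF1 hF2
    simp only [Int.natAbs_mul]
    rw [prod_mul_distrib, Nat.factorization_mul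
      (prod_ne_zero_iff.mpr fun k hk => Int.natAbs_ne_zero.mpr (h1 k (mem_range.mp hk)))
      (prod_ne_zero_iff.mpr fun k hk => Int.natAbs_ne_zero.mpr (h2 k (mem_range.mp hk))),
      Finsupp.add_apply]
    have hsum : rootCountSum p (F :: Fs) = rootCount p F + rootCountSum p Fs := by
      rw [rootCountSum, List.map_cons, List.sum_cons, rootCountSum]
    rw [hsum, add_mul, add_mul]
    exact ⟨add_le_add hF1 ih1, add_le_add hF2 ih2⟩

lemma lt_two_pow_of_quadratic {a c q : ℕ} (hq : a + 2 * c + 5 ≤ q) : a + c * (q + 2) < 2 ^ q := by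
  have h1 : ∀ q, 5 ≤ q → q ^ 2 < 2 ^ q := by
    intro q hq
    induction q, hq using Nat.le_induction with
    | base => norm_num
    | succ q hq ih => rw [pow_succ 2]; nlinarith
  refine lt_of_le_of_lt ?_ (h1 q (by omega))
  nlinarith

/-- If `∏ F (k) / ∏ G (k)`, over `1 ≤ k ≤ n`, is a given rational number, and `F` and `G` have
different numbers of roots modulo `p`, all simple, then `n` is bounded: the exponents of `p` in the
two products differ by at least `⌊n/p⌋` up to an error that is logarithmic in `n`. -/
theorem lt_of_mul_prod_prodEval_eq {A B : ℤ} (hA : A ≠ 0) (hB : B ≠ 0) {Fs Gs : List (List ℤ)}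
    (hFs : ∀ F ∈ Fs, HasSimpleRoots p F) (hGs : ∀ G ∈ Gs, HasSimpleRoots p G)
    (hne : rootCountSum p Fs ≠ rootCountSum p Gs) {H ℓ n : ℕ}
    (hH : ∀ F ∈ Fs ++ Gs, (F.map Int.natAbs).sum ≤ H ∧ F.length ≤ ℓ)
    (hF0 : ∀ k < n, prodEval Fs (k + 1) ≠ 0)
    (heq : A * ∏ k ∈ range n, prodEval Fs (k + 1) = B * ∏ k ∈ range n, prodEval Gs (k + 1)) :
    n < p ^ (A.natAbs + B.natAbs + (rootCountSum p Fs + rootCountSum p Gs) * (H + 2) +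
      2 * ((rootCountSum p Fs + rootCountSum p Gs) * ℓ) + 5 + 1) := by
  have hp : p.Prime := Fact.out
  by_contra! hn
  set RF := rootCountSum p Fs
  set RG := rootCountSum p Gs
  set W := A.natAbs + B.natAbs + (RF + RG) * (H + 2) + 2 * ((RF + RG) * ℓ) + 5 with hW
  have hpF : ∏ k ∈ range n, prodEval Fs (k + 1) ≠ 0 :=
    prod_ne_zero_iff.mpr fun k hk => hF0 k (mem_range.mp hk)
  have hpG : ∏ k ∈ range n, prodEval Gs (k + 1) ≠ 0 := fun h => by
    rw [h, mul_zero] at heq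
    exact mul_ne_zero hA hpF heq
  have hG0 : ∀ k < n, prodEval Gs (k + 1) ≠ 0 := fun k hk =>
    prod_ne_zero_iff.mp hpG k (mem_range.mpr hk)
  have hn0 : n ≠ 0 := by
    have := Nat.pow_pos (n := W + 1) hp.pos
    omega
  obtain ⟨q, hq⟩ : ∃ q, Nat.log p n = q + 1 := Nat.exists_eq_succ_of_ne_zero (by
    have := Nat.le_log_of_pow_le hp.one_lt hn
    omega)
  have hqW : W ≤ q := by
    have := Nat.le_log_of_pow_le hp.one_lt hn
    omega
  have hn1 : p ^ (q + 1) ≤ n := hq ▸ Nat.pow_log_le_self p hn0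
  have hn2 : n < p ^ (q + 2) := by
    have := Nat.lt_pow_succ_log_self hp.one_lt n
    rwa [hq] at this
  -- all the values involved are less than `p ^ b`
  set b := H + 2 + (q + 2) * ℓ with hb
  have hbound : ∀ F ∈ Fs ++ Gs, ∀ k < n, (listEval F (k + 1)).natAbs < p ^ b := by
    intro F hF k hk
    obtain ⟨h1, h2⟩ := hH F hF
    calc (listEval F (k + 1)).natAbs ≤ (F.map Int.natAbs).sum * (k + 1) ^ F.length :=
          natAbs_listEval_le F (by omega)
      _ ≤ H * (p ^ (q + 2)) ^ ℓ := by
          refine Nat.mul_le_mul h1 ?_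
          exact (Nat.pow_le_pow_left (by omega) _).trans
            (Nat.pow_le_pow_right (Nat.pow_pos hp.pos) h2)
      _ < p ^ (H + 1) * (p ^ (q + 2)) ^ ℓ := by
          refine Nat.mul_lt_mul_of_pos_right ?_ (Nat.pow_pos (Nat.pow_pos hp.pos))
          exact (Nat.lt_pow_self hp.one_lt).trans (Nat.pow_lt_pow_right hp.one_lt (by omega))
      _ = p ^ (H + 1 + (q + 2) * ℓ) := by rw [← pow_mul, ← pow_add]
      _ ≤ p ^ b := Nat.pow_le_pow_right hp.pos (by omega)
  obtain ⟨hF1, hF2⟩ := factorization_prod_prodEval hFs hF0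
    fun F hF => hbound F (List.mem_append_left _ hF)
  obtain ⟨hG1, hG2⟩ := factorization_prod_prodEval hGs hG0
    fun F hF => hbound F (List.mem_append_right _ hF)
  set T := ∑ j ∈ Ico 1 b, n / p ^ j
  -- the term `j = 1` alone is exponential in `q`, about `log_p n`, while `b` is linear in `q`
  have hT : 2 ^ q ≤ T := by
    calc 2 ^ q ≤ p ^ q := Nat.pow_le_pow_left hp.two_le q
      _ ≤ n / p ^ 1 := by
          rw [Nat.le_div_iff_mul_le (Nat.pow_pos hp.pos), ← pow_add]
          exact hn1
      _ ≤ T := single_le_sum (f := fun j => n / p ^ j) (fun _ _ => Nat.zero_le _)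
          (mem_Ico.mpr ⟨le_rfl, by omega⟩)
  change RF * T ≤ _ at hF1
  change _ ≤ RF * (T + b) at hF2
  change RG * T ≤ _ at hG1
  change _ ≤ RG * (T + b) at hG2
  have hval := congrArg (fun z : ℤ => z.natAbs.factorization p) heq
  have hnat : ∀ Hs : List (List ℤ), (∏ k ∈ range n, prodEval Hs (k + 1)).natAbs =
      ∏ k ∈ range n, (prodEval Hs (k + 1)).natAbs := fun Hs =>
    map_prod Int.natAbsHom _ _
  simp only [Int.natAbs_mul] at hval
  rw [Nat.factorization_mul (Int.natAbs_ne_zero.mpr hA) (Int.natAbs_ne_zero.mpr hpF),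
    Nat.factorization_mul (Int.natAbs_ne_zero.mpr hB) (Int.natAbs_ne_zero.mpr hpG),
    Finsupp.add_apply, Finsupp.add_apply, hnat, hnat] at hval
  have hvA := Nat.factorization_lt p (Int.natAbs_ne_zero.mpr hA)
  have hvB := Nat.factorization_lt p (Int.natAbs_ne_zero.mpr hB)
  -- the difference of the exponents is at least `T`, up to `(RF + RG) * b` and the constants
  have hTle : T ≤ A.natAbs + B.natAbs + (RF + RG) * b := by
    rcases lt_or_gt_of_ne hne with h | h
    · obtain ⟨d, hd⟩ := Nat.exists_eq_add_of_lt h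
      rw [hd] at hG1
      nlinarith
    · obtain ⟨d, hd⟩ := Nat.exists_eq_add_of_lt h
      rw [hd] at hF1
      nlinarith
  have hlast := lt_two_pow_of_quadratic (a := A.natAbs + B.natAbs + (RF + RG) * (H + 2))
    (c := (RF + RG) * ℓ) (q := q) (by omega)
  have : (RF + RG) * b = (RF + RG) * (H + 2) + (RF + RG) * ℓ * (q + 2) := by
    rw [hb]; ring
  omega

end Lists

/-! ### Primitive recursive integer arithmetic -/

section IntegerArithmetic
open Encodable Denumerable

variable {α β σ : Type*} [Primcodable α] [Primcodable β] [Primcodable σ]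

lemma primrec_int_toNat : Primrec Int.toNat := by
  rw [Primrec.ofNat_iff]
  have h : Primrec fun n : ℕ => if n % 2 = 0 then n / 2 else 0 :=
    Primrec.ite (Primrec.eq.comp (Primrec.nat_mod.comp .id (.const 2)) (.const 0))
      (Primrec.nat_div.comp .id (.const 2)) (.const 0)
  refine h.of_eq fun n => ?_
  obtain ⟨z, rfl⟩ : ∃ z : ℤ, encode z = n := ⟨ofNat ℤ n, encode_ofNat n⟩
  rw [ofNat_encode]
  rcases z with k | k
  · have : encode (Int.ofNat k) = 2 * k := rfl
    rw [this, if_pos (by omega)]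
    simp
  · have : encode (Int.negSucc k) = 2 * k + 1 := rfl
    rw [this, if_neg (by omega)]
    simp

lemma primrec_int_neg_toNat : Primrec fun z : ℤ => (-z).toNat := by
  rw [Primrec.ofNat_iff]
  have h : Primrec fun n : ℕ => if n % 2 = 0 then 0 else n / 2 + 1 :=
    Primrec.ite (Primrec.eq.comp (Primrec.nat_mod.comp .id (.const 2)) (.const 0))
      (.const 0) (Primrec.succ.comp (Primrec.nat_div.comp .id (.const 2)))
  refine h.of_eq fun n => ?_
  obtain ⟨z, rfl⟩ : ∃ z : ℤ, encode z = n := ⟨ofNat ℤ n, encode_ofNat n⟩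
  rw [ofNat_encode]
  rcases z with k | k
  · have : encode (Int.ofNat k) = 2 * k := rfl
    rw [this, if_pos (by omega)]
    simp
  · have : encode (Int.negSucc k) = 2 * k + 1 := rfl
    rw [this, if_neg (by omega)]
    omega

lemma primrec_int_subNat : Primrec₂ fun a b : ℕ => (a : ℤ) - b := by
  rw [← Primrec₂.encode_iff]
  have h : Primrec₂ fun a b : ℕ => if b ≤ a then 2 * (a - b) else 2 * (b - a - 1) + 1 :=
    Primrec.ite (Primrec.nat_le.comp .snd .fst)
      (Primrec.nat_mul.comp (.const 2) (Primrec.nat_sub.comp .fst .snd))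
      (Primrec.succ.comp (Primrec.nat_mul.comp (.const 2)
        (Primrec.nat_sub.comp (Primrec.nat_sub.comp .snd .fst) (.const 1))))
  refine h.of_eq fun a b => ?_
  have hpos : ∀ k : ℕ, encode (k : ℤ) = 2 * k := fun k => rfl
  have hneg : ∀ k : ℕ, encode (Int.negSucc k) = 2 * k + 1 := fun k => rfl
  split_ifs with hab
  · rw [← Nat.cast_sub hab, hpos]
  · rw [show (a : ℤ) - b = Int.negSucc (b - a - 1) by omega, hneg]

lemma primrec_int_add : Primrec₂ fun a b : ℤ => a + b := by
  have h : Primrec₂ fun a b : ℤ =>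
      ((a.toNat + b.toNat : ℕ) : ℤ) - ((-a).toNat + (-b).toNat : ℕ) :=
    primrec_int_subNat.comp
      (Primrec.nat_add.comp (primrec_int_toNat.comp .fst) (primrec_int_toNat.comp .snd))
      (Primrec.nat_add.comp (primrec_int_neg_toNat.comp .fst) (primrec_int_neg_toNat.comp .snd))
  exact h.of_eq fun a b => by omega

lemma primrec_int_mul : Primrec₂ fun a b : ℤ => a * b := by
  have h : Primrec₂ fun a b : ℤ =>
      ((a.toNat * b.toNat + (-a).toNat * (-b).toNat : ℕ) : ℤ) -
        (a.toNat * (-b).toNat + (-a).toNat * b.toNat : ℕ) :=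
    primrec_int_subNat.comp
      (Primrec.nat_add.comp
        (Primrec.nat_mul.comp (primrec_int_toNat.comp .fst) (primrec_int_toNat.comp .snd))
        (Primrec.nat_mul.comp (primrec_int_neg_toNat.comp .fst) (primrec_int_neg_toNat.comp .snd)))
      (Primrec.nat_add.comp
        (Primrec.nat_mul.comp (primrec_int_toNat.comp .fst) (primrec_int_neg_toNat.comp .snd))
        (Primrec.nat_mul.comp (primrec_int_neg_toNat.comp .fst) (primrec_int_toNat.comp .snd)))
  refine h.of_eq fun a b => ?_
  push_cast
  have ha : ((a.toNat : ℕ) : ℤ) - ((-a).toNat : ℕ) = a := by omega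
  have hb : ((b.toNat : ℕ) : ℤ) - ((-b).toNat : ℕ) = b := by omega
  calc _ = (((a.toNat : ℕ) : ℤ) - ((-a).toNat : ℕ)) * (((b.toNat : ℕ) : ℤ) - ((-b).toNat : ℕ)) := by
        ring
    _ = a * b := by rw [ha, hb]

lemma primrec_int_neg : Primrec fun a : ℤ => -a :=
  (primrec_int_mul.comp (.const (-1)) .id).of_eq fun a => neg_one_mul a

lemma primrec_int_natAbs : Primrec Int.natAbs :=
  (Primrec.nat_add.comp primrec_int_toNat primrec_int_neg_toNat).of_eq fun a => by omega

lemma primrec_int_natCast : Primrec fun n : ℕ => (n : ℤ) :=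
  (primrec_int_subNat.comp .id (.const 0)).of_eq fun n => by simp

lemma primrec_nat_pow : Primrec₂ fun a b : ℕ => a ^ b := Primrec₂.unpaired'.mp Nat.Primrec.pow

lemma primrec_list_sum {f : α → List ℕ} (hf : Primrec f) : Primrec fun a => (f a).sum :=
  (Primrec.list_foldr (h := fun _ q => q.1 + q.2) hf (.const 0)
    (Primrec.nat_add.comp (Primrec.fst.comp .snd) (Primrec.snd.comp .snd)).to₂).of_eq
    fun _ => rfl

lemma primrec_list_prod_int {f : α → List ℤ} (hf : Primrec f) : Primrec fun a => (f a).prod :=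
  (Primrec.list_foldr (h := fun _ q => q.1 * q.2) hf (.const 1)
    (primrec_int_mul.comp (Primrec.fst.comp .snd) (Primrec.snd.comp .snd)).to₂).of_eq
    fun _ => rfl

lemma primrecPred_forall_mem {f : α → List β} {P : α → β → Prop} (hf : Primrec f)
    (hP : PrimrecRel P) : PrimrecPred fun a => ∀ b ∈ f a, P a b :=
  hP.swap.forall_mem_list.comp hf .id

lemma primrecPred_forall_lt {f : α → ℕ} {P : α → ℕ → Prop} (hf : Primrec f)
    (hP : PrimrecRel P) : PrimrecPred fun a => ∀ n < f a, P a n :=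
  (primrecPred_forall_mem (Primrec.list_range.comp hf) hP).of_eq fun a => by
    simp only [List.mem_range]

end IntegerArithmetic

/-! ### Evaluation of polynomials and sequences given by codes -/

section Evaluation

lemma primrec_listEval : Primrec₂ listEval := by
  refine (Primrec.list_foldr (α := List ℤ × ℕ) (f := Prod.fst) (g := fun _ => (0 : ℤ))
    (h := fun q r => r.1 + (q.2 : ℤ) * r.2) .fst (.const 0) ?_).of_eq fun _ => rfl
  exact primrec_int_add.comp (Primrec.fst.comp .snd)
    (primrec_int_mul.comp (primrec_int_natCast.comp (Primrec.snd.comp .fst))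
      (Primrec.snd.comp .snd))

lemma primrec_prodEval : Primrec₂ prodEval := by
  refine primrec_list_prod_int (Primrec.list_map .fst ?_)
  exact primrec_listEval.comp .snd (Primrec.snd.comp .fst)

lemma primrec_rootCount : Primrec₂ rootCount := by
  have h : PrimrecRel fun (x : ℕ) (q : ℕ × List ℤ) => (listEval q.2 x).natAbs % q.1 = 0 :=
    Primrec.eq.comp (Primrec.nat_mod.comp (primrec_int_natAbs.comp
      (primrec_listEval.comp (Primrec.snd.comp .snd) .fst)) (Primrec.fst.comp .snd)) (.const 0)
  exact Primrec.list_length.comp (h.listFilter.comp (Primrec.list_range.comp .fst) .id)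

lemma primrec_rootCountSum : Primrec₂ rootCountSum := by
  refine primrec_list_sum (Primrec.list_map .snd ?_)
  exact primrec_rootCount.comp (Primrec.fst.comp .fst) .snd

lemma primrecRel_hasSimpleRoots : PrimrecRel HasSimpleRoots := by
  refine primrecPred_forall_lt (f := fun q : ℕ × List ℤ => q.1)
    (P := fun q x => (listEval q.2 x).natAbs % q.1 = 0 →
      ¬ (listEval q.2 (x + q.1) + -listEval q.2 x).natAbs % (q.1 * q.1) = 0) .fst ?_
  have hp : Primrec fun r : (ℕ × List ℤ) × ℕ => r.1.1 := Primrec.fst.comp .fst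
  have hl : Primrec fun r : (ℕ × List ℤ) × ℕ => r.1.2 := Primrec.snd.comp .fst
  have h1 : PrimrecPred fun r : (ℕ × List ℤ) × ℕ => (listEval r.1.2 r.2).natAbs % r.1.1 = 0 :=
    Primrec.eq.comp (Primrec.nat_mod.comp (primrec_int_natAbs.comp
      (primrec_listEval.comp hl .snd)) hp) (.const 0)
  have h2 : PrimrecPred fun r : (ℕ × List ℤ) × ℕ =>
      (listEval r.1.2 (r.2 + r.1.1) + -listEval r.1.2 r.2).natAbs % (r.1.1 * r.1.1) = 0 :=
    Primrec.eq.comp (Primrec.nat_mod.comp (primrec_int_natAbs.comp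
      (primrec_int_add.comp (primrec_listEval.comp hl (Primrec.nat_add.comp .snd hp))
        (primrec_int_neg.comp (primrec_listEval.comp hl .snd)))) (Primrec.nat_mul.comp hp hp))
      (.const 0)
  exact (h1.not.or h2.not).of_eq fun r => by tauto

lemma primrecPred_prime : PrimrecPred Nat.Prime := by
  have h : PrimrecPred fun p : ℕ => 2 ≤ p ∧ ∀ m < p, m = 1 ∨ ¬ p % m = 0 := by
    refine (Primrec.nat_le.comp (.const 2) .id).and (primrecPred_forall_lt .id ?_)
    exact (Primrec.eq.comp .snd (.const 1)).or
      (Primrec.eq.comp (Primrec.nat_mod.comp .fst .snd) (.const 0)).not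
  refine h.of_eq fun p => ?_
  rw [Nat.prime_def_lt]
  refine and_congr_right fun _ => forall₂_congr fun m _ => ?_
  rw [Nat.dvd_iff_mod_eq_zero]
  tauto

/-- The value at `x` of the polynomial with the given codes of coefficients, as a pair of a
numerator and a denominator. -/
def ratEval (l : List RatCode) (x : ℕ) : ℤ × ℤ :=
  l.foldr (fun c q => (c.1 * q.2 + x * q.1 * ((c.2 + 1 : ℕ) : ℤ), q.2 * ((c.2 + 1 : ℕ) : ℤ))) (0, 1)

lemma primrec_ratEval : Primrec₂ ratEval := by
  refine Primrec.list_foldr (h := fun (a : List RatCode × ℕ) (q : RatCode × (ℤ × ℤ)) =>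
    (q.1.1 * q.2.2 + (a.2 : ℤ) * q.2.1 * ((q.1.2 + 1 : ℕ) : ℤ), q.2.2 * ((q.1.2 + 1 : ℕ) : ℤ)))
    .fst (.const (0, 1)) ?_
  have hc1 : Primrec fun r : (List RatCode × ℕ) × (RatCode × (ℤ × ℤ)) => r.2.1.1 :=
    Primrec.fst.comp (Primrec.fst.comp .snd)
  have hc2 : Primrec fun r : (List RatCode × ℕ) × (RatCode × (ℤ × ℤ)) =>
      ((r.2.1.2 + 1 : ℕ) : ℤ) :=
    primrec_int_natCast.comp (Primrec.succ.comp (Primrec.snd.comp (Primrec.fst.comp .snd)))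
  have hq1 : Primrec fun r : (List RatCode × ℕ) × (RatCode × (ℤ × ℤ)) => r.2.2.1 :=
    Primrec.fst.comp (Primrec.snd.comp .snd)
  have hq2 : Primrec fun r : (List RatCode × ℕ) × (RatCode × (ℤ × ℤ)) => r.2.2.2 :=
    Primrec.snd.comp (Primrec.snd.comp .snd)
  have hx : Primrec fun r : (List RatCode × ℕ) × (RatCode × (ℤ × ℤ)) => (r.1.2 : ℤ) :=
    primrec_int_natCast.comp (Primrec.snd.comp .fst)
  exact (primrec_int_add.comp (primrec_int_mul.comp hc1 hq2)
    (primrec_int_mul.comp (primrec_int_mul.comp hx hq1) hc2)).pair (primrec_int_mul.comp hq2 hc2)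

lemma ratEval_snd_ne_zero (l : List RatCode) (x : ℕ) : (ratEval l x).2 ≠ 0 := by
  induction l with
  | nil => exact one_ne_zero
  | cons c l ih => exact mul_ne_zero ih (by positivity)

lemma ratEval_spec (l : List RatCode) (x : ℕ) :
    (polyOfCodes l).eval (x : ℚ) * ((ratEval l x).2 : ℚ) = (ratEval l x).1 := by
  induction l with
  | nil => simp [polyOfCodes, ratEval]
  | cons c l ih =>
    have h1 : (ratEval (c :: l) x).1 =
        c.1 * (ratEval l x).2 + x * (ratEval l x).1 * ((c.2 + 1 : ℕ) : ℤ) := rfl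
    have h2 : (ratEval (c :: l) x).2 = (ratEval l x).2 * ((c.2 + 1 : ℕ) : ℤ) := rfl
    have h3 : (c.2 : ℚ) + 1 ≠ 0 := by positivity
    rw [h1, h2, polyOfCodes, eval_add, eval_C, eval_mul, eval_X, RatCode.value]
    push_cast
    rw [← ih]
    field_simp

/-- The term `u n` of the sequence given by an instance `i` of the Membership Problem, as a pair of
a numerator and a denominator. The components of `i` are the codes `i.1` of `f`, `i.2.1` of `g`,
`i.2.2.1` of `u 0`, and `i.2.2.2` of the target. -/
def termEval (i : MembershipInput) (n : ℕ) : ℤ × ℤ :=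
  Nat.rec (i.2.2.1.1, ((i.2.2.1.2 + 1 : ℕ) : ℤ))
    (fun k q => (q.1 * ((ratEval i.2.1 (k + 1)).1 * (ratEval i.1 (k + 1)).2),
      q.2 * ((ratEval i.2.1 (k + 1)).2 * (ratEval i.1 (k + 1)).1))) n

lemma primrec_termEval : Primrec₂ termEval := by
  have hc : Primrec fun i : MembershipInput => i.2.2.1 :=
    Primrec.fst.comp (Primrec.snd.comp .snd)
  refine Primrec.nat_rec (α := MembershipInput) (β := ℤ × ℤ)
    (f := fun i => (i.2.2.1.1, ((i.2.2.1.2 + 1 : ℕ) : ℤ)))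
    (g := fun i (r : ℕ × (ℤ × ℤ)) =>
      (r.2.1 * ((ratEval i.2.1 (r.1 + 1)).1 * (ratEval i.1 (r.1 + 1)).2),
        r.2.2 * ((ratEval i.2.1 (r.1 + 1)).2 * (ratEval i.1 (r.1 + 1)).1))) ?_ ?_
  · exact (Primrec.fst.comp hc).pair
      (primrec_int_natCast.comp (Primrec.succ.comp (Primrec.snd.comp hc)))
  · have hk : Primrec fun r : MembershipInput × (ℕ × (ℤ × ℤ)) => r.2.1 + 1 :=
      Primrec.succ.comp (Primrec.fst.comp .snd)
    have hg : Primrec fun r : MembershipInput × (ℕ × (ℤ × ℤ)) => ratEval r.1.2.1 (r.2.1 + 1) :=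
      primrec_ratEval.comp (Primrec.fst.comp (Primrec.snd.comp .fst)) hk
    have hf : Primrec fun r : MembershipInput × (ℕ × (ℤ × ℤ)) => ratEval r.1.1 (r.2.1 + 1) :=
      primrec_ratEval.comp (Primrec.fst.comp .fst) hk
    have hq : Primrec fun r : MembershipInput × (ℕ × (ℤ × ℤ)) => r.2.2 := Primrec.snd.comp .snd
    exact (primrec_int_mul.comp (Primrec.fst.comp hq)
      (primrec_int_mul.comp (Primrec.fst.comp hg) (Primrec.snd.comp hf))).pair
      (primrec_int_mul.comp (Primrec.snd.comp hq)
        (primrec_int_mul.comp (Primrec.snd.comp hg) (Primrec.fst.comp hf)))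

/-- The term of index `n` is the target, for an instance of the Membership Problem. -/
def HitsTarget (i : MembershipInput) (n : ℕ) : Prop :=
  (termEval i n).1 * ((i.2.2.2.2 + 1 : ℕ) : ℤ) = i.2.2.2.1 * (termEval i n).2

lemma primrec_target : Primrec fun i : MembershipInput => i.2.2.2 :=
  Primrec.snd.comp (Primrec.snd.comp .snd)

lemma primrecRel_hitsTarget : PrimrecRel HitsTarget := by
  have ht : Primrec fun r : MembershipInput × ℕ => r.1.2.2.2 := primrec_target.comp .fst
  exact Primrec.eq.comp
    (primrec_int_mul.comp (Primrec.fst.comp primrec_termEval)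
      (primrec_int_natCast.comp (Primrec.succ.comp (Primrec.snd.comp ht))))
    (primrec_int_mul.comp (Primrec.fst.comp ht) (Primrec.snd.comp primrec_termEval))

end Evaluation

/-! ### Factorizations given by lists of coefficients -/

section Factorizations

/-- The lists `Fs` of coefficients define a factorization of `D` times the polynomial with the codes
`c` of coefficients. This is tested at more points than the degrees of both sides. -/
def IsFactorization (c : List RatCode) (D : ℤ) (Fs : List (List ℤ)) : Prop :=
  ∀ x < c.length + Fs.flatten.length + 1, D * (ratEval c x).1 = (ratEval c x).2 * prodEval Fs x

lemma natDegree_polyOfCodes_le (c : List RatCode) : (polyOfCodes c).natDegree ≤ c.length := by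
  induction c with
  | nil => simp [polyOfCodes]
  | cons a c ih =>
    rw [polyOfCodes, List.length_cons]
    refine natDegree_add_le_of_degree_le ((natDegree_C _).trans_le (Nat.zero_le _)) ?_
    exact natDegree_mul_le.trans (by rw [natDegree_X]; omega)

lemma listPoly_cons (a : ℤ) (l : List ℤ) : listPoly (a :: l) = C a + X * listPoly l := rfl

lemma natDegree_listPoly_le (l : List ℤ) : (listPoly l).natDegree ≤ l.length := by
  induction l with
  | nil => simp [listPoly]
  | cons a l ih =>
    rw [listPoly_cons, List.length_cons]
    refine natDegree_add_le_of_degree_le ((natDegree_C _).trans_le (Nat.zero_le _)) ?_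
    exact natDegree_mul_le.trans (by rw [natDegree_X]; omega)

lemma natDegree_prod_listPoly_le (Fs : List (List ℤ)) :
    ((Fs.map listPoly).prod).natDegree ≤ Fs.flatten.length := by
  induction Fs with
  | nil => simp
  | cons F Fs ih =>
    rw [List.map_cons, List.prod_cons, List.flatten_cons, List.length_append]
    exact natDegree_mul_le.trans (add_le_add (natDegree_listPoly_le F) ih)

lemma eval_prod_listPoly (Fs : List (List ℤ)) (x : ℕ) :
    ((Fs.map listPoly).prod).eval (x : ℤ) = prodEval Fs x := by
  induction Fs with
  | nil => simp [prodEval]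
  | cons F Fs ih =>
    rw [List.map_cons, List.prod_cons, eval_mul, ih, eval_listPoly, prodEval_cons]

lemma eval_map_prod_listPoly (Fs : List (List ℤ)) (x : ℕ) :
    (((Fs.map listPoly).prod).map (Int.castRingHom ℚ)).eval (x : ℚ) = (prodEval Fs x : ℚ) := by
  rw [← eval_prod_listPoly, eval_map, ← Int.cast_natCast (R := ℚ) x,
    ← eq_intCast (Int.castRingHom ℚ) (x : ℤ), eval₂_at_apply, eq_intCast]

lemma isFactorization_iff (c : List RatCode) (D : ℤ) (Fs : List (List ℤ)) :
    IsFactorization c D Fs ↔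
      C (D : ℚ) * polyOfCodes c = ((Fs.map listPoly).prod).map (Int.castRingHom ℚ) := by
  have key : ∀ x : ℕ, D * (ratEval c x).1 = (ratEval c x).2 * prodEval Fs x ↔
      (C (D : ℚ) * polyOfCodes c).eval (x : ℚ) =
        (((Fs.map listPoly).prod).map (Int.castRingHom ℚ)).eval (x : ℚ) := by
    intro x
    have h : ((ratEval c x).2 : ℚ) ≠ 0 := Int.cast_ne_zero.mpr (ratEval_snd_ne_zero c x)
    rw [eval_map_prod_listPoly, eval_mul, eval_C, ← mul_left_inj' h, mul_assoc, ratEval_spec,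
      mul_comm (prodEval Fs x : ℚ)]
    exact_mod_cast Iff.rfl
  constructor
  · intro h
    refine eq_of_natDegree_lt_card_of_eval_eq _ _
      (f := fun x : Fin (c.length + Fs.flatten.length + 1) => ((x : ℕ) : ℚ))
      (fun x y hxy => Fin.ext (Nat.cast_injective hxy)) (fun x => (key x).mp (h x x.2)) ?_
    rw [Fintype.card_fin]
    have h1 := (natDegree_C_mul_le (D : ℚ) (polyOfCodes c)).trans (natDegree_polyOfCodes_le c)
    have h2 := (natDegree_map_le (f := Int.castRingHom ℚ) (p := (Fs.map listPoly).prod)).trans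
      (natDegree_prod_listPoly_le Fs)
    omega
  · intro h x _
    rw [key, h]

lemma IsFactorization.eval_eq {c : List RatCode} {D : ℤ} {Fs : List (List ℤ)}
    (h : IsFactorization c D Fs) (x : ℕ) :
    (D : ℚ) * (polyOfCodes c).eval (x : ℚ) = prodEval Fs x := by
  have := congrArg (eval (x : ℚ)) ((isFactorization_iff c D Fs).mp h)
  rwa [eval_mul, eval_C, eval_map_prod_listPoly] at this

lemma exists_listPoly_eq (F : ℤ[X]) : ∃ l : List ℤ, listPoly l = F := by
  obtain ⟨n, hn⟩ : ∃ n, F.natDegree < n := ⟨_, Nat.lt_succ_self _⟩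
  induction n generalizing F with
  | zero => omega
  | succ n ih =>
    by_cases h : F.natDegree = 0
    · obtain ⟨a, rfl⟩ := natDegree_eq_zero.mp h
      exact ⟨[a], by simp [listPoly]⟩
    · obtain ⟨l, hl⟩ := ih F.divX (by rw [natDegree_divX_eq_natDegree_tsub_one]; omega)
      refine ⟨F.coeff 0 :: l, ?_⟩
      rw [listPoly_cons, hl, add_comm, X_mul_divX_add]

/-- The sum of the absolute values of all coefficients. -/
def coeffSum (Fs : List (List ℤ)) : ℕ := (Fs.flatten.map Int.natAbs).sum

lemma coeffSum_cons (F : List ℤ) (Fs : List (List ℤ)) :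
    coeffSum (F :: Fs) = (F.map Int.natAbs).sum + coeffSum Fs := by
  rw [coeffSum, List.flatten_cons, List.map_append, List.sum_append, coeffSum]

lemma sum_natAbs_le_coeffSum {F : List ℤ} {Fs : List (List ℤ)} (hF : F ∈ Fs) :
    (F.map Int.natAbs).sum ≤ coeffSum Fs ∧ F.length ≤ Fs.flatten.length := by
  induction Fs with
  | nil => simp at hF
  | cons G Fs ih =>
    rw [coeffSum_cons, List.flatten_cons, List.length_append]
    rcases List.mem_cons.mp hF with rfl | h
    · omega
    · have := ih h
      omega

/-- A nonzero integer polynomial has no integer zero beyond the sum of the absolute values of its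
coefficients, because a positive zero divides the lowest nonzero coefficient. -/
lemma listPoly_eq_zero_of_listEval_eq_zero {l : List ℤ} {x : ℕ} (hx : (l.map Int.natAbs).sum < x)
    (h : listEval l x = 0) : listPoly l = 0 := by
  induction l with
  | nil => rfl
  | cons a l ih =>
    rw [List.map_cons, List.sum_cons] at hx
    have h' : a + x * listEval l x = 0 := h
    have ha : a = 0 := by
      refine Int.eq_zero_of_dvd_of_natAbs_lt_natAbs (d := (x : ℤ)) ?_ ?_
      · exact (dvd_add_left (dvd_mul_right _ _)).mp (h' ▸ dvd_zero _)
      · rw [Int.natAbs_natCast]; omega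
    subst ha
    rw [zero_add, mul_eq_zero] at h'
    rw [listPoly_cons, ih (by omega) (h'.resolve_left (by omega))]
    simp

lemma prodEval_ne_zero {Fs : List (List ℤ)} (h0 : (Fs.map listPoly).prod ≠ 0) {x : ℕ}
    (hx : coeffSum Fs < x) : prodEval Fs x ≠ 0 := by
  induction Fs with
  | nil => simp [prodEval]
  | cons F Fs ih =>
    rw [List.map_cons, List.prod_cons] at h0
    rw [coeffSum_cons] at hx
    rw [prodEval_cons]
    exact mul_ne_zero
      (fun h => left_ne_zero_of_mul h0 (listPoly_eq_zero_of_listEval_eq_zero (by omega) h))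
      (ih (right_ne_zero_of_mul h0) (by omega))

end Factorizations

/-! ### Certificates -/

section Search
open Finset

/-- Candidates for a certificate: an index `n`, two lists of polynomials with integer coefficients,
an integer `D`, and a prime `p`. The lists are meant to be the factors of `D * f` and `D * g`. -/
abbrev Certificate := ℕ × List (List ℤ) × List (List ℤ) × ℤ × ℕ

/-- A bound for the indices at which a nonzero target can be attained, when `Fs` and `Gs` are the
factors of `f` and `g` and have different numbers of roots modulo `p`, all simple. This is the bound
of `lt_of_mul_prod_prodEval_eq`. -/
def searchBound (i : MembershipInput) (Fs Gs : List (List ℤ)) (p : ℕ) : ℕ :=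
  p ^ ((i.2.2.2.1 * ((i.2.2.1.2 + 1 : ℕ) : ℤ)).natAbs +
    (i.2.2.1.1 * ((i.2.2.2.2 + 1 : ℕ) : ℤ)).natAbs +
    (rootCountSum p Fs + rootCountSum p Gs) * (coeffSum (Fs ++ Gs) + 2) +
    2 * ((rootCountSum p Fs + rootCountSum p Gs) * (Fs ++ Gs).flatten.length) + 5 + 1)

/-- The target is zero, and `n` is an index beyond the zeros of `g` with `u n ≠ 0`. The positive
integer zeros of `g` are at most the sum of the absolute values of the coefficients of the factors
of `D * g`. -/
def IsNonvanishingCertificate (i : MembershipInput) (c : Certificate) : Prop :=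
  i.2.2.2.1 = 0 ∧ c.2.2.2.1 ≠ 0 ∧ IsFactorization i.2.1 c.2.2.2.1 c.2.2.1 ∧
    coeffSum c.2.2.1 ≤ c.1 ∧ (termEval i c.1).1 ≠ 0

/-- The target is not zero, the factors of `f` and `g` have different numbers of roots modulo `p`,
all simple, and the target is not attained up to the resulting bound. -/
def IsPrimeCertificate (i : MembershipInput) (c : Certificate) : Prop :=
  i.2.2.2.1 ≠ 0 ∧ c.2.2.2.1 ≠ 0 ∧ IsFactorization i.1 c.2.2.2.1 c.2.1 ∧
    IsFactorization i.2.1 c.2.2.2.1 c.2.2.1 ∧ c.2.2.2.2.Prime ∧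
    (∀ F ∈ c.2.1 ++ c.2.2.1, HasSimpleRoots c.2.2.2.2 F) ∧
    rootCountSum c.2.2.2.2 c.2.1 ≠ rootCountSum c.2.2.2.2 c.2.2.1 ∧
    ∀ k < searchBound i c.2.1 c.2.2.1 c.2.2.2.2, ¬ HitsTarget i k

/-- The candidate `c` certifies that the target is not attained. -/
def IsNegativeCertificate (i : MembershipInput) (c : Certificate) : Prop :=
  IsNonvanishingCertificate i c ∨ IsPrimeCertificate i c

section Primrec

variable {α : Type*} [Primcodable α]

lemma primrec_coeffSum : Primrec coeffSum :=
  primrec_list_sum (Primrec.list_map Primrec.list_flatten (primrec_int_natAbs.comp .snd).to₂)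

lemma primrecPred_isFactorization {c : α → List RatCode} {D : α → ℤ} {Fs : α → List (List ℤ)}
    (hc : Primrec c) (hD : Primrec D) (hFs : Primrec Fs) :
    PrimrecPred fun a => IsFactorization (c a) (D a) (Fs a) := by
  refine primrecPred_forall_lt (f := fun a => (c a).length + (Fs a).flatten.length + 1)
    (P := fun a x => D a * (ratEval (c a) x).1 = (ratEval (c a) x).2 * prodEval (Fs a) x) ?_ ?_
  · exact Primrec.succ.comp (Primrec.nat_add.comp (Primrec.list_length.comp hc)
      (Primrec.list_length.comp (Primrec.list_flatten.comp hFs)))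
  · have h : Primrec fun r : α × ℕ => ratEval (c r.1) r.2 :=
      primrec_ratEval.comp (hc.comp .fst) .snd
    exact Primrec.eq.comp (primrec_int_mul.comp (hD.comp .fst) (Primrec.fst.comp h))
      (primrec_int_mul.comp (Primrec.snd.comp h) (primrec_prodEval.comp (hFs.comp .fst) .snd))

lemma primrec_searchBound {i : α → MembershipInput} {Fs Gs : α → List (List ℤ)} {p : α → ℕ}
    (hi : Primrec i) (hFs : Primrec Fs) (hGs : Primrec Gs) (hp : Primrec p) :
    Primrec fun a => searchBound (i a) (Fs a) (Gs a) (p a) := by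
  have ht : Primrec fun a => (i a).2.2.2 := primrec_target.comp hi
  have hc : Primrec fun a => (i a).2.2.1 :=
    Primrec.fst.comp (Primrec.snd.comp (Primrec.snd.comp hi))
  have hA : Primrec fun a => ((i a).2.2.2.1 * (((i a).2.2.1.2 + 1 : ℕ) : ℤ)).natAbs :=
    primrec_int_natAbs.comp (primrec_int_mul.comp (Primrec.fst.comp ht)
      (primrec_int_natCast.comp (Primrec.succ.comp (Primrec.snd.comp hc))))
  have hB : Primrec fun a => ((i a).2.2.1.1 * (((i a).2.2.2.2 + 1 : ℕ) : ℤ)).natAbs :=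
    primrec_int_natAbs.comp (primrec_int_mul.comp (Primrec.fst.comp hc)
      (primrec_int_natCast.comp (Primrec.succ.comp (Primrec.snd.comp ht))))
  have hR : Primrec fun a => rootCountSum (p a) (Fs a) + rootCountSum (p a) (Gs a) :=
    Primrec.nat_add.comp (primrec_rootCountSum.comp hp hFs) (primrec_rootCountSum.comp hp hGs)
  have happ : Primrec fun a => Fs a ++ Gs a := Primrec.list_append.comp hFs hGs
  have hH : Primrec fun a => coeffSum (Fs a ++ Gs a) + 2 :=
    Primrec.nat_add.comp (primrec_coeffSum.comp happ) (.const 2)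
  have hl : Primrec fun a => (Fs a ++ Gs a).flatten.length :=
    Primrec.list_length.comp (Primrec.list_flatten.comp happ)
  exact primrec_nat_pow.comp hp (Primrec.nat_add.comp (Primrec.nat_add.comp (Primrec.nat_add.comp
    (Primrec.nat_add.comp (Primrec.nat_add.comp hA hB) (Primrec.nat_mul.comp hR hH))
    (Primrec.nat_mul.comp (.const 2) (Primrec.nat_mul.comp hR hl))) (.const 5)) (.const 1))

lemma primrecRel_isNegativeCertificate : PrimrecRel IsNegativeCertificate := by
  have hi : Primrec fun r : MembershipInput × Certificate => r.1 := .fst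
  have hcf : Primrec fun r : MembershipInput × Certificate => r.1.1 := Primrec.fst.comp hi
  have hcg : Primrec fun r : MembershipInput × Certificate => r.1.2.1 :=
    Primrec.fst.comp (Primrec.snd.comp hi)
  have ht : Primrec fun r : MembershipInput × Certificate => r.1.2.2.2.1 :=
    Primrec.fst.comp (primrec_target.comp hi)
  have hn : Primrec fun r : MembershipInput × Certificate => r.2.1 := Primrec.fst.comp .snd
  have hFs : Primrec fun r : MembershipInput × Certificate => r.2.2.1 :=
    Primrec.fst.comp (Primrec.snd.comp .snd)
  have hGs : Primrec fun r : MembershipInput × Certificate => r.2.2.2.1 :=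
    Primrec.fst.comp (Primrec.snd.comp (Primrec.snd.comp .snd))
  have hD : Primrec fun r : MembershipInput × Certificate => r.2.2.2.2.1 :=
    Primrec.fst.comp (Primrec.snd.comp (Primrec.snd.comp (Primrec.snd.comp .snd)))
  have hp : Primrec fun r : MembershipInput × Certificate => r.2.2.2.2.2 :=
    Primrec.snd.comp (Primrec.snd.comp (Primrec.snd.comp (Primrec.snd.comp .snd)))
  have ht0 : PrimrecPred fun r : MembershipInput × Certificate => r.1.2.2.2.1 = 0 :=
    Primrec.eq.comp ht (.const 0)
  have hD0 : PrimrecPred fun r : MembershipInput × Certificate => r.2.2.2.2.1 = 0 :=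
    Primrec.eq.comp hD (.const 0)
  have hterm : PrimrecPred fun r : MembershipInput × Certificate => (termEval r.1 r.2.1).1 = 0 :=
    Primrec.eq.comp (Primrec.fst.comp (primrec_termEval.comp hi hn)) (.const 0)
  have hhit : PrimrecRel fun (r : MembershipInput × Certificate) (k : ℕ) => ¬ HitsTarget r.1 k :=
    (primrecRel_hitsTarget.comp (Primrec.fst.comp .fst) .snd).not
  have hfacG := primrecPred_isFactorization hcg hD hGs
  have h1 : PrimrecPred fun r : MembershipInput × Certificate =>
      IsNonvanishingCertificate r.1 r.2 :=
    ht0.and (hD0.not.and (hfacG.and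
      ((Primrec.nat_le.comp (primrec_coeffSum.comp hGs) hn).and hterm.not)))
  have hsimple : PrimrecPred fun r : MembershipInput × Certificate =>
      ∀ F ∈ r.2.2.1 ++ r.2.2.2.1, HasSimpleRoots r.2.2.2.2.2 F :=
    primrecPred_forall_mem (Primrec.list_append.comp hFs hGs)
      (P := fun (r : MembershipInput × Certificate) F => HasSimpleRoots r.2.2.2.2.2 F)
      (primrecRel_hasSimpleRoots.comp (hp.comp .fst) .snd)
  have h2 : PrimrecPred fun r : MembershipInput × Certificate => IsPrimeCertificate r.1 r.2 :=
    ht0.not.and (hD0.not.and ((primrecPred_isFactorization hcf hD hFs).and (hfacG.and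
      ((primrecPred_prime.comp hp).and (hsimple.and
        ((Primrec.eq.comp (primrec_rootCountSum.comp hp hFs)
          (primrec_rootCountSum.comp hp hGs)).not.and
        (primrecPred_forall_lt (primrec_searchBound hi hFs hGs hp) hhit)))))))
  exact h1.or h2

open Classical in
/-- The answer that the candidate with code `s` justifies, if any. -/
noncomputable def answer (i : MembershipInput) (s : ℕ) : Option Bool :=
  (Encodable.decode (α := Certificate) s).bind fun c =>
    if HitsTarget i c.1 then some true else if IsNegativeCertificate i c then some false else none

lemma primrec_answer : Primrec₂ answer := by
  classical
  refine Primrec.option_bind (Primrec.decode.comp .snd) ?_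
  refine Primrec.ite (primrecRel_hitsTarget.comp (Primrec.fst.comp .fst) (Primrec.fst.comp .snd))
    (.const _) (Primrec.ite ?_ (.const _) (.const _))
  exact primrecRel_isNegativeCertificate.comp (Primrec.fst.comp .fst) .snd

end Primrec

end Search

/-! ### A certificate excludes the target -/

section Soundness
open Finset

variable {cf cg : List RatCode} {c₀ ct : RatCode} {u : ℕ → ℚ}

lemma RatCode.value_eq_zero_iff (c : RatCode) : RatCode.value c = 0 ↔ c.1 = 0 := by
  have h : (c.2 : ℚ) + 1 ≠ 0 := by positivity
  rw [RatCode.value, div_eq_zero_iff, or_iff_left h, Int.cast_eq_zero]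

lemma RatCode.value_mul (c : RatCode) : RatCode.value c * ((c.2 + 1 : ℕ) : ℤ) = c.1 := by
  have h : (c.2 : ℚ) + 1 ≠ 0 := by positivity
  rw [RatCode.value]
  push_cast
  exact div_mul_cancel₀ _ h

lemma termEval_spec (hu : IsHypergeometric (polyOfCodes cf) (polyOfCodes cg) u)
    (h0 : u 0 = RatCode.value c₀) (n : ℕ) :
    (termEval (cf, cg, c₀, ct) n).2 ≠ 0 ∧
      u n * (termEval (cf, cg, c₀, ct) n).2 = (termEval (cf, cg, c₀, ct) n).1 := by
  induction n with
  | zero =>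
    refine ⟨?_, ?_⟩
    · change ((c₀.2 + 1 : ℕ) : ℤ) ≠ 0
      positivity
    · rw [h0]
      exact RatCode.value_mul c₀
  | succ n ih =>
    obtain ⟨ih1, ih2⟩ := ih
    have h1 : (termEval (cf, cg, c₀, ct) (n + 1)).1 = (termEval (cf, cg, c₀, ct) n).1 *
      ((ratEval cg (n + 1)).1 * (ratEval cf (n + 1)).2) := rfl
    have h2 : (termEval (cf, cg, c₀, ct) (n + 1)).2 = (termEval (cf, cg, c₀, ct) n).2 *
      ((ratEval cg (n + 1)).2 * (ratEval cf (n + 1)).1) := rfl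
    have hf := ratEval_spec cf (n + 1)
    have hg := ratEval_spec cg (n + 1)
    have hf0 := hu.den_ne_zero (n + 1) (by omega)
    have hf1 : (ratEval cf (n + 1)).1 ≠ 0 := by
      intro h
      rw [h, Int.cast_zero] at hf
      exact mul_ne_zero hf0 (Int.cast_ne_zero.mpr (ratEval_snd_ne_zero cf _)) hf
    refine ⟨?_, ?_⟩
    · rw [h2]
      exact mul_ne_zero ih1 (mul_ne_zero (ratEval_snd_ne_zero cg _) hf1)
    · have hrec := hu.recurrence n
      rw [h1, h2]
      push_cast
      rw [← hf, ← hg, ← ih2]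
      linear_combination (↑(termEval (cf, cg, c₀, ct) n).2 * ↑(ratEval cg (n + 1)).2 *
        ↑(ratEval cf (n + 1)).2) * hrec

lemma termEval_fst_eq_zero_iff (hu : IsHypergeometric (polyOfCodes cf) (polyOfCodes cg) u)
    (h0 : u 0 = RatCode.value c₀) (n : ℕ) :
    (termEval (cf, cg, c₀, ct) n).1 = 0 ↔ u n = 0 := by
  obtain ⟨h1, h2⟩ := termEval_spec (ct := ct) hu h0 n
  rw [← Int.cast_eq_zero (α := ℚ), ← h2, mul_eq_zero, or_iff_left (Int.cast_ne_zero.mpr h1)]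

lemma hitsTarget_iff (hu : IsHypergeometric (polyOfCodes cf) (polyOfCodes cg) u)
    (h0 : u 0 = RatCode.value c₀) (n : ℕ) :
    HitsTarget (cf, cg, c₀, ct) n ↔ u n = RatCode.value ct := by
  obtain ⟨h1, h2⟩ := termEval_spec (ct := ct) hu h0 n
  have h1' : ((termEval (cf, cg, c₀, ct) n).2 : ℚ) ≠ 0 := Int.cast_ne_zero.mpr h1
  have h3 : (((ct.2 + 1 : ℕ) : ℤ) : ℚ) ≠ 0 := by positivity
  change (termEval (cf, cg, c₀, ct) n).1 * ((ct.2 + 1 : ℕ) : ℤ) =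
    ct.1 * (termEval (cf, cg, c₀, ct) n).2 ↔ _
  rw [← Int.cast_inj (α := ℚ), Int.cast_mul, Int.cast_mul, ← h2, ← RatCode.value_mul ct]
  constructor
  · intro h
    apply mul_right_cancel₀ (mul_ne_zero h1' h3)
    linear_combination h
  · intro h
    rw [h]
    ring

lemma eq_zero_of_le {f g : ℚ[X]} (hu : IsHypergeometric f g u) {m n : ℕ} (hmn : m ≤ n)
    (hm : u m = 0) : u n = 0 := by
  induction n, hmn using Nat.le_induction with
  | base => exact hm
  | succ n _ ih =>
    have := hu.recurrence n
    rw [ih, mul_zero] at this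
    exact (mul_eq_zero.mp this).resolve_left (hu.den_ne_zero (n + 1) (by omega))

lemma ne_zero_of_isNonvanishingCertificate
    (hu : IsHypergeometric (polyOfCodes cf) (polyOfCodes cg) u) (h0 : u 0 = RatCode.value c₀)
    {c : Certificate} (hc : IsNonvanishingCertificate (cf, cg, c₀, ct) c) (m : ℕ) :
    u m ≠ RatCode.value ct := by
  obtain ⟨ht, hD, hG, hn, hun⟩ := hc
  rw [(RatCode.value_eq_zero_iff ct).mpr ht]
  rw [Ne, termEval_fst_eq_zero_iff hu h0] at hun
  have hprod : (c.2.2.1.map listPoly).prod ≠ 0 := by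
    intro h
    have := (isFactorization_iff _ _ _).mp hG
    rw [h, Polynomial.map_zero] at this
    exact mul_ne_zero (C_ne_zero.mpr (Int.cast_ne_zero.mpr hD)) hu.num_ne_zero this
  have hlarge : ∀ k, c.1 ≤ k → u k ≠ 0 := by
    intro k hk
    induction k, hk using Nat.le_induction with
    | base => exact hun
    | succ k hk ih =>
      intro hzero
      have hrec := hu.recurrence k
      rw [hzero, mul_zero] at hrec
      have hg : (polyOfCodes cg).eval ((k + 1 : ℕ) : ℚ) ≠ 0 := by
        intro h
        have := IsFactorization.eval_eq hG (k + 1)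
        rw [h, mul_zero] at this
        exact prodEval_ne_zero hprod (by omega) (Int.cast_eq_zero.mp this.symm)
      exact mul_ne_zero hg ih hrec.symm
  exact fun hm => hlarge _ (le_max_left c.1 m) (eq_zero_of_le hu (le_max_right _ _) hm)

/-- The solved form of the recurrence, in terms of factorizations of the coefficients. -/
lemma mul_prod_prodEval_eq {f g : ℚ[X]} (hu : IsHypergeometric f g u) {D : ℚ}
    {P Q : ℕ → ℤ} (hf : ∀ x : ℕ, D * f.eval (x : ℚ) = P x)
    (hg : ∀ x : ℕ, D * g.eval (x : ℚ) = Q x) (n : ℕ) :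
    u n * ((∏ k ∈ range n, P (k + 1) : ℤ) : ℚ) = u 0 * ((∏ k ∈ range n, Q (k + 1) : ℤ) : ℚ) := by
  induction n with
  | zero => simp
  | succ n ih =>
    have hrec := hu.recurrence n
    rw [prod_range_succ, prod_range_succ, Int.cast_mul, Int.cast_mul, ← hf, ← hg]
    linear_combination (D * ((∏ k ∈ range n, P (k + 1) : ℤ) : ℚ)) * hrec +
      D * g.eval ((n + 1 : ℕ) : ℚ) * ih

lemma ne_of_isPrimeCertificate (hu : IsHypergeometric (polyOfCodes cf) (polyOfCodes cg) u)
    (h0 : u 0 = RatCode.value c₀) {c : Certificate}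
    (hc : IsPrimeCertificate (cf, cg, c₀, ct) c) (m : ℕ) : u m ≠ RatCode.value ct := by
  obtain ⟨ht, hD, hF, hG, hp, hsimple, hne, hsearch⟩ := hc
  intro hm
  have : Fact c.2.2.2.2.Prime := ⟨hp⟩
  have hF0 : ∀ k < m, prodEval c.2.1 (k + 1) ≠ 0 := by
    intro k _ h
    have := IsFactorization.eval_eq hF (k + 1)
    rw [h, Int.cast_zero] at this
    exact mul_ne_zero (Int.cast_ne_zero.mpr hD) (hu.den_ne_zero (k + 1) (by omega)) this
  have hA : ct.1 * ((c₀.2 + 1 : ℕ) : ℤ) ≠ 0 := mul_ne_zero ht (by positivity)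
  have heq : (ct.1 * ((c₀.2 + 1 : ℕ) : ℤ)) * ∏ k ∈ range m, prodEval c.2.1 (k + 1) =
      (c₀.1 * ((ct.2 + 1 : ℕ) : ℤ)) * ∏ k ∈ range m, prodEval c.2.2.1 (k + 1) := by
    have h1 := mul_prod_prodEval_eq hu (IsFactorization.eval_eq hF) (IsFactorization.eval_eq hG) m
    rw [hm, h0] at h1
    rw [← Int.cast_inj (α := ℚ)]
    simp only [Int.cast_mul]
    rw [← RatCode.value_mul ct, ← RatCode.value_mul c₀]
    linear_combination ((((c₀.2 + 1 : ℕ) : ℤ) : ℚ) * (((ct.2 + 1 : ℕ) : ℤ) : ℚ)) * h1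
  have hB : c₀.1 * ((ct.2 + 1 : ℕ) : ℤ) ≠ 0 := by
    intro h
    rw [h, zero_mul] at heq
    exact mul_ne_zero hA (prod_ne_zero_iff.mpr fun k hk => hF0 k (mem_range.mp hk)) heq
  refine hsearch m ?_ ((hitsTarget_iff hu h0 m).mpr hm)
  exact lt_of_mul_prod_prodEval_eq hA hB
    (fun F hF => hsimple F (List.mem_append_left _ hF))
    (fun G hG => hsimple G (List.mem_append_right _ hG)) hne
    (fun F hF => sum_natAbs_le_coeffSum hF) hF0 heq

lemma ne_of_isNegativeCertificate (hu : IsHypergeometric (polyOfCodes cf) (polyOfCodes cg) u)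
    (h0 : u 0 = RatCode.value c₀) {c : Certificate}
    (hc : IsNegativeCertificate (cf, cg, c₀, ct) c) (m : ℕ) : u m ≠ RatCode.value ct := by
  rcases hc with hc | hc
  · exact ne_zero_of_isNonvanishingCertificate hu h0 hc m
  · exact ne_of_isPrimeCertificate hu h0 hc m

end Soundness

/-! ### Existence of certificates -/

section Completeness
open Filter

variable {cf cg : List RatCode} {c₀ ct : RatCode} {u : ℕ → ℚ}

/-- Every nonzero multiple of a suitable integer `D` admits a factorization: a constant factor makes
up for the difference. Thus `f` and `g` have factorizations with the same integer. -/
lemma exists_list_factorization {f : ℚ[X]} (hf : f ≠ 0) :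
    ∃ D : ℤ, D ≠ 0 ∧ ∀ E : ℤ, E ≠ 0 → ∃ Fs : List (List ℤ),
      IsIntFactorization f (E * D) (Fs.map listPoly) := by
  obtain ⟨D, Fs, hFs⟩ := exists_isIntFactorization hf
  refine ⟨D, hFs.ne_zero, fun E hE => ?_⟩
  choose l hl using exists_listPoly_eq
  refine ⟨(C E :: Fs).map l, ?_⟩
  have hmap : ((C E :: Fs).map l).map listPoly = C E :: Fs := by
    rw [List.map_map]
    exact (List.map_congr_left fun F _ => hl F).trans (List.map_id _)
  rw [hmap]
  refine ⟨mul_ne_zero hE hFs.ne_zero, ?_, fun F hF => ?_⟩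
  · rw [List.map_cons, List.prod_cons, ← hFs.C_mul_eq, map_C, Int.cast_mul, C_mul, mul_assoc]
    rfl
  · rcases List.mem_cons.mp hF with rfl | hF
    · exact ⟨C_ne_zero.mpr hE, Or.inl (natDegree_C E)⟩
    · exact hFs.factors F hF

lemma IsIntFactorization.isFactorization {c : List RatCode} {D : ℤ} {Fs : List (List ℤ)}
    (h : IsIntFactorization (polyOfCodes c) D (Fs.map listPoly)) : IsFactorization c D Fs := by
  rw [isFactorization_iff, h.C_mul_eq, ← coe_mapRingHom, map_list_prod]

lemma eventually_hasSimpleRoots {l : List ℤ} (h0 : listPoly l ≠ 0)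
    (h : (listPoly l).natDegree = 0 ∨ Irreducible ((listPoly l).map (Int.castRingHom ℚ))) :
    ∀ᶠ p : ℕ in atTop, p.Prime → HasSimpleRoots p l := by
  rcases h with h | h
  · filter_upwards [eventually_modRoots_eq_empty h0 h] with p hempty hp
    have : Fact p.Prime := ⟨hp⟩
    rw [hasSimpleRoots_iff, hempty]
    exact fun x hx => absurd hx (Set.notMem_empty x)
  · filter_upwards [eventually_simple_roots h] with p hsimple hp
    have : Fact p.Prime := ⟨hp⟩
    exact (hasSimpleRoots_iff l).mpr (hsimple this)

lemma exists_isNonvanishingCertificate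
    (hu : IsHypergeometric (polyOfCodes cf) (polyOfCodes cg) u) (h0 : u 0 = RatCode.value c₀)
    (ht : ct.1 = 0) (hne : ∀ n, u n ≠ RatCode.value ct) :
    ∃ c : Certificate, IsNonvanishingCertificate (cf, cg, c₀, ct) c := by
  obtain ⟨D, hD, h⟩ := exists_list_factorization hu.num_ne_zero
  obtain ⟨Gs, hG⟩ := h 1 one_ne_zero
  refine ⟨(coeffSum Gs, [], Gs, 1 * D, 0), ht, mul_ne_zero one_ne_zero hD,
    hG.isFactorization, le_rfl, ?_⟩
  rw [Ne, termEval_fst_eq_zero_iff hu h0, ← (RatCode.value_eq_zero_iff ct).mpr ht]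
  exact hne _

lemma exists_isPrimeCertificate (hu : IsHypergeometric (polyOfCodes cf) (polyOfCodes cg) u)
    (h0 : u 0 = RatCode.value c₀) (hsame : ¬ SameRootFields (polyOfCodes cf) (polyOfCodes cg))
    (hcond : FactorsDegreeLeTwo (polyOfCodes cf * polyOfCodes cg) ∨
      CyclicSplittingField (polyOfCodes cf * polyOfCodes cg))
    (ht : ct.1 ≠ 0) (hne : ∀ n, u n ≠ RatCode.value ct) :
    ∃ c : Certificate, IsPrimeCertificate (cf, cg, c₀, ct) c := by
  have hf0 : polyOfCodes cf ≠ 0 := by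
    intro h
    apply hu.den_ne_zero 1 le_rfl
    rw [h, eval_zero]
  obtain ⟨D, hD, hDf⟩ := exists_list_factorization hf0
  obtain ⟨E, hE, hEg⟩ := exists_list_factorization hu.num_ne_zero
  obtain ⟨Fs, hFs⟩ := hDf E hE
  obtain ⟨Gs, hGs⟩ := hEg D hD
  rw [mul_comm D E] at hGs
  have hmem : ∀ l ∈ Fs ++ Gs, listPoly l ≠ 0 ∧ ((listPoly l).natDegree = 0 ∨
      Irreducible ((listPoly l).map (Int.castRingHom ℚ))) := by
    intro l hl
    rcases List.mem_append.mp hl with h | h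
    · exact hFs.factors _ (List.mem_map_of_mem h)
    · exact hGs.factors _ (List.mem_map_of_mem h)
  have hsimple : ∀ᶠ p : ℕ in atTop, ∀ l ∈ {l | l ∈ Fs ++ Gs}, p.Prime → HasSimpleRoots p l := by
    rw [eventually_all_finite (List.finite_toSet _)]
    exact fun l hl => eventually_hasSimpleRoots (hmem l hl).1 (hmem l hl).2
  obtain ⟨B, hB⟩ := eventually_atTop.mp hsimple
  obtain ⟨p, hpB, hp, hcount⟩ := exists_prime_sum_ncard_ne_of_cond
    (mul_ne_zero hf0 hu.num_ne_zero) hsame hcond hFs hGs B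
  have : Fact p.Prime := ⟨hp⟩
  have hroot : ∀ Hs : List (List ℤ),
      ((Hs.map listPoly).map fun F => (modRoots F p).ncard).sum = rootCountSum p Hs := by
    intro Hs
    rw [List.map_map, rootCountSum]
    exact congrArg List.sum (List.map_congr_left fun l _ => (rootCount_eq_ncard l).symm)
  rw [hroot, hroot] at hcount
  refine ⟨(0, Fs, Gs, E * D, p), ht, hFs.ne_zero, hFs.isFactorization,
    hGs.isFactorization, hp, fun F hF => hB p hpB F hF hp, hcount, fun k _ => ?_⟩
  rw [hitsTarget_iff hu h0]
  exact hne k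

lemma exists_isNegativeCertificate (hu : ClassD (polyOfCodes cf) (polyOfCodes cg) u)
    (h0 : u 0 = RatCode.value c₀)
    (hcond : FactorsDegreeLeTwo (polyOfCodes cf * polyOfCodes cg) ∨
      CyclicSplittingField (polyOfCodes cf * polyOfCodes cg))
    (hne : ∀ n, u n ≠ RatCode.value ct) :
    ∃ c : Certificate, IsNegativeCertificate (cf, cg, c₀, ct) c := by
  by_cases ht : ct.1 = 0
  · exact (exists_isNonvanishingCertificate hu.hypergeometric h0 ht hne).imp fun _ => Or.inl
  · exact (exists_isPrimeCertificate hu.hypergeometric h0 hu.not_same hcond ht hne).imp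
      fun _ => Or.inr

end Completeness

/-! ### Correctness of the search -/

section Decision

variable {cf cg : List RatCode} {c₀ ct : RatCode} {u : ℕ → ℚ}

lemma answer_correct (hu : IsHypergeometric (polyOfCodes cf) (polyOfCodes cg) u)
    (h0 : u 0 = RatCode.value c₀) {s : ℕ} {b : Bool} (hb : b ∈ answer (cf, cg, c₀, ct) s) :
    b = true ↔ ∃ n, u n = RatCode.value ct := by
  obtain ⟨c, -, hc⟩ := Option.bind_eq_some_iff.mp hb
  split_ifs at hc with h1 h2
  · obtain rfl : true = b := Option.some.inj hc
    exact ⟨fun _ => ⟨c.1, (hitsTarget_iff hu h0 _).mp h1⟩, fun _ => rfl⟩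
  · obtain rfl : false = b := Option.some.inj hc
    refine ⟨fun h => absurd h Bool.false_ne_true, fun ⟨n, hn⟩ => ?_⟩
    exact absurd hn (ne_of_isNegativeCertificate hu h0 h2 n)

lemma exists_mem_answer {i : MembershipInput} {c : Certificate}
    (h : HitsTarget i c.1 ∨ IsNegativeCertificate i c) : ∃ s b, b ∈ answer i s := by
  classical
  have hdec : ∀ b : Bool, (if HitsTarget i c.1 then some true
      else if IsNegativeCertificate i c then some false else none) = some b →
      b ∈ answer i (Encodable.encode c) := by
    intro b hb
    rw [answer, Encodable.encodek, Option.mem_def, Option.bind_some]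
    convert hb
  by_cases h1 : HitsTarget i c.1
  · exact ⟨_, true, hdec true (by rw [if_pos h1])⟩
  · exact ⟨_, false, hdec false (by rw [if_neg h1, if_pos (h.resolve_left h1)])⟩

end Decision
end HypergeometricMembership

theorem mainTheorem4 :
    HypergeometricMembership.MembershipDecidable (fun f g u =>
      HypergeometricMembership.ClassD f g u ∧
        (HypergeometricMembership.FactorsDegreeLeTwo (f * g) ∨
          HypergeometricMembership.CyclicSplittingField (f * g))) := by
  refine ⟨fun i => Nat.rfindOpt (HypergeometricMembership.answer i),
    Partrec.rfindOpt HypergeometricMembership.primrec_answer.to_comp, ?_⟩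
  intro cf cg c₀ ct u hu h0 ⟨hD, hcond⟩
  have hfound : ∃ s b, b ∈ HypergeometricMembership.answer (cf, cg, c₀, ct) s := by
    by_cases h : ∃ n, u n = HypergeometricMembership.RatCode.value ct
    · obtain ⟨n, hn⟩ := h
      exact HypergeometricMembership.exists_mem_answer (c := (n, [], [], 0, 0))
        (Or.inl ((HypergeometricMembership.hitsTarget_iff hu h0 n).mpr hn))
    · push Not at h
      obtain ⟨c, hc⟩ := HypergeometricMembership.exists_isNegativeCertificate hD h0 hcond h
      exact HypergeometricMembership.exists_mem_answer (Or.inr hc)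
  refine ⟨_, Part.get_mem (Nat.rfindOpt_dom.mpr hfound), ?_⟩
  obtain ⟨s, hs⟩ := Nat.rfindOpt_spec (Part.get_mem (Nat.rfindOpt_dom.mpr hfound))
  exact HypergeometricMembership.answer_correct hu h0 hs
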